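/- Let $r,s\ge 1$ be integers and set $d=2s-2$ and $n=r+d$. *Composition graph.* $C(r,s)$ is the graph on the tuples $(a_1,\dots,a_s)$ of non-negative integers with sum $r$ (weak compositions) in which two tuples are adjacent if they differ by one in exactly two positions and all entries strictly between these positions are $0$. *The complex $\mathcal C(r,s)$.* A lattice path in $[r]\times[s]$ is the vertex set of a path from $(1,1)$ to $(r,s)$ by unit steps increasing one coordinate; a partial lattice path is a subset of a lattice path. The simplices of the staircase triangulation $\Sigma(r,s)$ of $\Delta^{r-1}\times\Delta^{s-1}\subset\mathbb R^r\times\mathbb R^s$ are the sets $\operatorname{conv}\{(e_i,e_j):(i,j)\in\lambda\}$, for nonempty partial lattice paths $\lambda$. With $L=\{(x,y): x=(\tfrac1r,\dots,\tfrac1r)\}$, the cells of $\mathcal C(r,s)=\Sigma(r,s)\cap L$ are the nonempty sets $\sigma\cap L$ for simplices $\sigma$ of $\Sigma(r,s)$. *The polar-to-cyclic polytope.* Let $t_1<\dots<t_n$ be real, $C_d(n)=\operatorname{conv}\{\mu(t_1),\dots,\mu(t_n)\}\subset\mathbb R^d$ with $\mu(t)=(t,t^2,\dots,t^d)$, and let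 $c$ be any interior point of $C_d(n)$. Put $C_d(n)^\Delta=\{y\in\mathbb R^d:\langle y,x-c\rangle\le 1\text{ for all }x\in C_d(n)\}$; its vertex $y$ is dual to the facet $\{x\in C_d(n):\langle y,x-c\rangle=1\}$. A facet $F$ of $C_d(n)$ with index set $I=\{i:\mu(t_i)\in F\}$ is a *lower facet* if the last block of contiguous elements of $I$ has even cardinality. (For $s=1$, $C_0(n)$ is a point, whose only facet is the empty face; it is lower.) If $I=\{i_1,i_1+1,\dots,i_{d/2},i_{d/2}+1\}$ is the index set of a lower facet $F$, its vector of hole sizes is $\chi(F)=(i_{j+1}-i_j-2)_{0\le j\le d/2}$, where $i_0=-1$, $i_{d/2+1}=n+1$. **Theorem.** Let $K$ be the subcomplex of $C_d(n)^\Delta$ induced on the vertices dual to lower facets, i.e. the family of all nonempty faces of $C_d(n)^\Delta$ all of whose vertices are dual to lower facets of $C_d(n)$. Then: 1. $\mathcal C(r,s)$ and $K$ are isomorphic, that is, their posets of nonempty cells, ordered by inclusion, are isomorphic. 2. Every face in $K$ has dimension at most $d/2$. 3. The 1-skeleton of each of the two complexes is the graph $C(r,s)$. For $\mathcal C(r,s)$,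 the vertex that corresponds to the weak composition $a$ is the point $\bigl((\tfrac1r,\dots,\tfrac1r),\tfrac1r a\bigr)$; for $K$, it is the vertex dual to the lower facet $F$ with $\chi(F)=a$. -/

import Mathlib

noncomputable section

/-! ### Weak compositions -/

/-- Weak compositions of `r` into `s` parts. -/
abbrev WeakComposition (r s : ℕ) : Type := {a : Fin s → ℕ // ∑ k, a k = r}

/-- The composition graph `C(r,s)`: two weak compositions are adjacent if they differ, by one, in
exactly two positions, and all entries strictly between these two positions are `0`. -/
def compositionGraph (r s : ℕ) : SimpleGraph (WeakComposition r s) where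
  Adj a b := ∃ i j : Fin s, i < j ∧
    (∀ k, k ≠ i → k ≠ j → a.1 k = b.1 k) ∧
    (∀ k, i < k → k < j → a.1 k = 0) ∧
    ((a.1 i = b.1 i + 1 ∧ b.1 j = a.1 j + 1) ∨ (b.1 i = a.1 i + 1 ∧ a.1 j = b.1 j + 1))
  symm := ⟨by
    rintro a b ⟨i, j, hij, h, h0, h1⟩
    refine ⟨i, j, hij, fun k hi hj => (h k hi hj).symm, fun k hi hj => ?_, h1.symm⟩
    rw [← h k hi.ne' hj.ne]
    exact h0 k hi hj⟩
  loopless := ⟨by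
    rintro a ⟨i, j, -, -, -, h | h⟩
    · exact absurd h.1 (by omega)
    · exact absurd h.1 (by omega)⟩

/-! ### Families of cells, dimension, and 1-skeleton -/

/-- The dimension of (the affine hull of) a set, with the convention `dim ∅ = -1`. -/
def affineDim {E : Type*} [AddCommGroup E] [Module ℝ E] (S : Set E) : ℤ :=
  open Classical in if S = ∅ then -1 else (Module.finrank ℝ (vectorSpan ℝ S) : ℤ)

/-- The 1-skeleton of a polytopal complex, given as the family `K` of its nonempty cells: its
vertices are the points `p` with `{p} ∈ K`, and two distinct ones are adjacent if the segment
between them is a cell. -/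
def oneSkeleton {E : Type*} [AddCommGroup E] [Module ℝ E] (K : Set (Set E)) :
    SimpleGraph {p : E // {p} ∈ K} where
  Adj p q := p ≠ q ∧ segment ℝ p.1 q.1 ∈ K
  symm := ⟨fun p q h => ⟨h.1.symm, by rw [segment_symm]; exact h.2⟩⟩
  loopless := ⟨fun _ h => h.1 rfl⟩

/-! ### The staircase triangulation and its slice -/

/-- A lattice path in the grid `[r] × [s]` (here with coordinates starting at `0`), as a set of
vertices: it leads from the first to the last grid point by unit steps that increase exactly one
of the two coordinates. -/
def IsLatticePath {r s : ℕ} (l : Finset (Fin r × Fin s)) : Prop :=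
  ∃ (m : ℕ) (p : ℕ → Fin r × Fin s),
    ((p 0).1.val = 0 ∧ (p 0).2.val = 0) ∧
    ((p m).1.val + 1 = r ∧ (p m).2.val + 1 = s) ∧
    (∀ k < m,
      ((p (k + 1)).1.val = (p k).1.val + 1 ∧ (p (k + 1)).2 = (p k).2) ∨
      ((p (k + 1)).1 = (p k).1 ∧ (p (k + 1)).2.val = (p k).2.val + 1)) ∧
    l = (Finset.range (m + 1)).image p

/-- A partial lattice path: a subset of a lattice path. -/
def IsPartialLatticePath {r s : ℕ} (l : Finset (Fin r × Fin s)) : Prop :=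
  ∃ l' : Finset (Fin r × Fin s), IsLatticePath l' ∧ l ⊆ l'

/-- The vertex `(e_i, e_j)` of the product of simplices `Δ^{r-1} × Δ^{s-1} ⊆ ℝ^r × ℝ^s`. -/
def productVertex {r s : ℕ} (v : Fin r × Fin s) : (Fin r → ℝ) × (Fin s → ℝ) :=
  (Pi.single v.1 1, Pi.single v.2 1)

/-- The (nonempty) simplices of the staircase triangulation `Σ(r,s)`. -/
def staircaseTriangulation (r s : ℕ) : Set (Set ((Fin r → ℝ) × (Fin s → ℝ))) :=
  {S | ∃ l : Finset (Fin r × Fin s), l.Nonempty ∧ IsPartialLatticePath l ∧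
    S = convexHull ℝ (productVertex '' (l : Set (Fin r × Fin s)))}

/-- The plane `L` on which the first factor equals `(1/r, …, 1/r)`. -/
def slicePlane (r s : ℕ) : Set ((Fin r → ℝ) × (Fin s → ℝ)) :=
  {x | ∀ i, x.1 i = 1 / (r : ℝ)}

/-- The complex `𝒞(r,s) = Σ(r,s) ∩ L`: its cells are the nonempty intersections of the simplices
of the staircase triangulation with `L`. -/
def mixedSubdivision (r s : ℕ) : Set (Set ((Fin r → ℝ) × (Fin s → ℝ))) :=
  {C | C.Nonempty ∧ ∃ S ∈ staircaseTriangulation r s, C = S ∩ slicePlane r s}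

/-! ### Cyclic polytopes and their polars -/

/-- The moment curve `t ↦ (t, t², …, t^d)`. -/
def momentCurve (d : ℕ) (t : ℝ) : Fin d → ℝ := fun i => t ^ (i.val + 1)

/-- The standard realization of the cyclic polytope `C_d(n)` with parameters `t`. -/
def cyclicPolytope (d : ℕ) {n : ℕ} (t : Fin n → ℝ) : Set (Fin d → ℝ) :=
  convexHull ℝ (Set.range fun i => momentCurve d (t i))

/-- `F` is a facet of the polytope `P`: a face of codimension one. (With Mathlib's `IsExposed`,
the empty set is a face; it is the facet of a point.) -/
def IsFacet {d : ℕ} (P F : Set (Fin d → ℝ)) : Prop :=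
  IsExposed ℝ P F ∧ affineDim F = affineDim P - 1

/-- The index set of a face `F` of the cyclic polytope with parameters `t`. -/
def indexSet (d : ℕ) {n : ℕ} (t : Fin n → ℝ) (F : Set (Fin d → ℝ)) : Finset (Fin n) :=
  open Classical in {i | momentCurve d (t i) ∈ F}

/-- The end-set of `I`: the last block of contiguous elements of `I`. -/
def endSet {n : ℕ} (I : Finset (Fin n)) : Finset (Fin n) :=
  open Classical in {i ∈ I | ∀ j, i ≤ j → (∃ k ∈ I, j ≤ k) → j ∈ I}

/-- Lower facets of the cyclic polytope: facets whose index set has an end-set of even size. -/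
def IsLowerFacet (d : ℕ) {n : ℕ} (t : Fin n → ℝ) (F : Set (Fin d → ℝ)) : Prop :=
  IsFacet (cyclicPolytope d t) F ∧ Even (endSet (indexSet d t F)).card

/-- The sizes of the holes in the index set `I = {i₁, i₁ + 1, …, i_m, i_m + 1}` of a lower facet:
the `k`-th entry (counted from `0`) is the number of indices outside `I` that come after exactly
`k` of the `m` pairs, that is, `i_{k+1} - i_k - 2` (with indices counted from `1`, and with
`i_0 = -1` and `i_{m+1} = n + 1`). -/
def holeSize {n : ℕ} (I : Finset (Fin n)) (k : ℕ) : ℕ :=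
  (({h | h ∉ I ∧ ({i ∈ I | i < h} : Finset (Fin n)).card = 2 * k} : Finset (Fin n))).card

/-- The polar of `P` when the point `c` is taken as the origin. -/
def polarPolytope {d : ℕ} (P : Set (Fin d → ℝ)) (c : Fin d → ℝ) : Set (Fin d → ℝ) :=
  {y | ∀ x ∈ P, dotProduct y (x - c) ≤ 1}

/-- The face of `P` dual to the vertex `y` of the polar of `P` with respect to `c`. -/
def dualFace {d : ℕ} (P : Set (Fin d → ℝ)) (c y : Fin d → ℝ) : Set (Fin d → ℝ) :=
  {x ∈ P | dotProduct y (x - c) = 1}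

/-- The subcomplex of the face complex of the polytope `Q` induced on the set `W` of vertices:
all nonempty faces of `Q` whose vertices all lie in `W`. -/
def inducedSubcomplex {d : ℕ} (Q W : Set (Fin d → ℝ)) : Set (Set (Fin d → ℝ)) :=
  {F | IsExposed ℝ Q F ∧ F.Nonempty ∧ F.extremePoints ℝ ⊆ W}

/-- The vertices of the polar-to-cyclic polytope that are dual to lower facets. -/
def lowerDualVertices (d : ℕ) {n : ℕ} (t : Fin n → ℝ) (c : Fin d → ℝ) : Set (Fin d → ℝ) :=
  {y ∈ (polarPolytope (cyclicPolytope d t) c).extremePoints ℝ |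
    IsLowerFacet d t (dualFace (cyclicPolytope d t) c y)}

/-- The subcomplex of the polar-to-cyclic polytope induced on the vertices dual to lower facets. -/
def lowerPolarComplex (d : ℕ) {n : ℕ} (t : Fin n → ℝ) (c : Fin d → ℝ) : Set (Set (Fin d → ℝ)) :=
  inducedSubcomplex (polarPolytope (cyclicPolytope d t) c) (lowerDualVertices d t c)

end

/-! ### Points of the polar as polynomials; lower facets as positive leading coefficients -/

section SlackPolynomials

open Polynomial

/-! ### Sign conditions on polynomials -/

/-! Both complexes have the same combinatorial model: cells are the chains in the grid `[r] × [s]`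
that meet every row, and vertices are the graphs of monotone maps `[r] → [s]`, that is, weak
compositions via fibre sizes. `IsChainComplex` records what such a model must satisfy; the order
isomorphism and the 1-skeleton follow formally, because two graphs span an edge exactly when the
maps differ in one row, which is adjacency in `compositionGraph` (`adj_fiberComposition_iff`).

For the slice of the staircase triangulation, a point is a coupling of the uniform row distribution
with a column distribution, supported on a chain. Such a coupling is unique (`coupling_unique`), and
its support meets every row because every row has mass `1/r`.

For the polar, a point `y` becomes the polynomial `slackPoly c y` of degree at most `d`, nonnegative
at all parameters and normalized at `c`. A face is determined by the largest set of parameters at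
which its points may be nonzero (`exists_eq_polarFace`). A vertex has exactly `d` zeros, and it is
dual to a lower facet iff its coefficient of degree `d` is positive. As this coefficient is affine
in `y`, the complex consists of the nonempty faces on which it is positive throughout
(`mem_lowerPolarComplex_iff`).

The map `(i, j) ↦ i + 2j` sends chains to supports. A row-covering chain leaves `s - 1` indices free
that interlace with `s` others, and the divided difference at these `d + 1` nodes shows that the
leading coefficient is positive (`coeff_pos_of_mem_polarFace`). Conversely
(`exists_chain_of_mem_lowerPolarComplex`), if the support of a relative interior point were not of
this kind, then either the zeros are covered by too few adjacent pairs, and an explicit polynomial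
in the face has nonpositive leading coefficient, or a missed row yields `s` separated zeros, and a
divided difference has the wrong sign. The free `s - 1 = d/2` indices also bound the dimension. -/

theorem sign_prod_sub {m : ℕ} {x : Fin m → ℝ} (hx : StrictMono x) (k : Fin m) (S : Finset (Fin m))
    (hk : k ∉ S) :
    0 < (-1 : ℝ) ^ (S.filter (k < ·)).card * ∏ i ∈ S, (x k - x i) := by
  induction S using Finset.induction_on with
  | empty => simp
  | insert a S ha ih =>
    rw [Finset.mem_insert, not_or] at hk
    have ih := ih hk.2
    rw [Finset.prod_insert ha, Finset.filter_insert]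
    split_ifs with h
    · rw [Finset.card_insert_of_notMem (by simp [ha]), pow_succ]
      have := hx h
      have := mul_pos ih (sub_pos.2 this)
      linarith
    · have h' : a < k := lt_of_le_of_ne (not_lt.1 h) (Ne.symm hk.1)
      have := mul_pos ih (sub_pos.2 (hx h'))
      linarith

theorem coeff_eq_sum_div {d : ℕ} {x : Fin (d + 1) → ℝ} (hx : StrictMono x) {p : ℝ[X]}
    (hp : p.natDegree ≤ d) :
    p.coeff d = ∑ k, p.eval (x k) / ∏ l ∈ Finset.univ.erase k, (x k - x l) := by
  have := Lagrange.coeff_eq_sum (s := Finset.univ) (v := x) (P := p) hx.injective.injOn (by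
    simpa using degree_le_of_natDegree_le hp |>.trans_lt (by exact_mod_cast Nat.lt_succ_self d))
  simpa using this

/-- The coefficient is the divided difference of `p` at the nodes. The denominator at node `k` has
sign `(-1)^(d-k)`, so every summand is nonnegative; if the sum is zero, then `p` has `d + 1` roots.
-/
theorem coeff_nonneg_of_alternating {d : ℕ} {x : Fin (d + 1) → ℝ} (hx : StrictMono x) {p : ℝ[X]}
    (hp : p.natDegree ≤ d) (h : ∀ k : Fin (d + 1), 0 ≤ (-1 : ℝ) ^ (d - k.val) * p.eval (x k)) :
    0 ≤ p.coeff d ∧ (p.coeff d = 0 → p = 0) := by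
  have hterm : ∀ k : Fin (d + 1),
      0 ≤ p.eval (x k) / ∏ l ∈ Finset.univ.erase k, (x k - x l) ∧
      (p.eval (x k) / ∏ l ∈ Finset.univ.erase k, (x k - x l) = 0 → p.eval (x k) = 0) := by
    intro k
    have h1 := sign_prod_sub hx k (Finset.univ.erase k) (by simp)
    have h2 : ((Finset.univ.erase k).filter (k < ·)).card = d - k.val := by
      have : (Finset.univ.erase k).filter (k < ·) = Finset.Ioi k := by
        ext i; simp only [Finset.mem_filter, Finset.mem_erase, Finset.mem_univ, Finset.mem_Ioi]
        constructor
        · exact fun h => h.2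
        · exact fun h => ⟨⟨h.ne', trivial⟩, h⟩
      rw [this, Fin.card_Ioi]; omega
    rw [h2] at h1
    have h3 := h k
    set D := ∏ l ∈ Finset.univ.erase k, (x k - x l)
    have hD : D ≠ 0 := by rintro h0; rw [h0] at h1; simp at h1
    refine ⟨?_, fun h0 => by simpa [hD] using h0⟩
    rw [← mul_div_mul_left _ _ (pow_ne_zero (d - k.val) (by norm_num : (-1 : ℝ) ≠ 0))]
    exact div_nonneg h3 h1.le
  rw [coeff_eq_sum_div hx hp]
  refine ⟨Finset.sum_nonneg fun k _ => (hterm k).1, fun h0 => ?_⟩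
  rw [Finset.sum_eq_zero_iff_of_nonneg fun k _ => (hterm k).1] at h0
  exact eq_zero_of_natDegree_lt_card_of_eval_eq_zero p hx.injective
    (fun k => (hterm k).2 (h0 k (Finset.mem_univ k))) (by simpa using Nat.lt_succ_of_le hp)

theorem coeff_pos_of_even_nonneg {d : ℕ} (hd : Even d) {x : Fin (d + 1) → ℝ} (hx : StrictMono x)
    {p : ℝ[X]} (hp : p.natDegree ≤ d) (hp0 : p ≠ 0)
    (he : ∀ k : Fin (d + 1), Even k.val → 0 ≤ p.eval (x k))
    (ho : ∀ k : Fin (d + 1), ¬ Even k.val → p.eval (x k) = 0) : 0 < p.coeff d := by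
  obtain ⟨h1, h2⟩ := coeff_nonneg_of_alternating hx hp (fun k => by
    by_cases hk : Even k.val
    · rw [Even.neg_one_pow (hd.tsub hk), one_mul]; exact he k hk
    · rw [ho k hk, mul_zero])
  exact lt_of_le_of_ne h1 fun h => hp0 (h2 h.symm)

/-- This is the alternating criterion for `-p`: since `d` is even, `d - k` is odd at the odd nodes.
-/
theorem coeff_nonpos_of_odd_nonneg {d : ℕ} (hd : Even d) {x : Fin (d + 1) → ℝ} (hx : StrictMono x)
    {p : ℝ[X]} (hp : p.natDegree ≤ d)
    (he : ∀ k : Fin (d + 1), Even k.val → p.eval (x k) = 0)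
    (ho : ∀ k : Fin (d + 1), ¬ Even k.val → 0 ≤ p.eval (x k)) : p.coeff d ≤ 0 := by
  have := (coeff_nonneg_of_alternating (p := -p) hx (by simpa using hp) (fun k => by
    by_cases hk : Even k.val
    · simp [he k hk]
    · have : Odd (d - k.val) :=
        Nat.Even.sub_odd (by omega) hd (Nat.not_even_iff_odd.1 hk)
      simpa [this.neg_one_pow] using ho k hk)).1
  simpa using this

/-- A polynomial of degree at most `d` with `d` prescribed roots is a multiple of their nodal
polynomial. -/
theorem eq_smul_nodal {d n : ℕ} {t : Fin n → ℝ} (ht : StrictMono t) {I : Finset (Fin n)}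
    (hI : I.card = d) {p : ℝ[X]} (hp : p.natDegree ≤ d) (h : ∀ i ∈ I, p.eval (t i) = 0) :
    p = C (p.coeff d) * Lagrange.nodal I t := by
  have hN : (Lagrange.nodal I t).natDegree = d := by rw [Lagrange.natDegree_nodal, hI]
  have hc : (Lagrange.nodal I t).coeff d = 1 := by
    have := (Lagrange.nodal_monic (s := I) (v := t)).coeff_natDegree
    rwa [hN] at this
  rw [← sub_eq_zero]
  refine Polynomial.eq_zero_of_degree_lt_of_eval_index_eq_zero (v := t) I
    ht.injective.injOn ?_ ?_
  · rw [hI, degree_lt_iff_coeff_zero]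
    intro m hm
    rw [coeff_sub, coeff_C_mul]
    rcases hm.eq_or_lt with rfl | hm
    · simp [hc]
    · rw [coeff_eq_zero_of_natDegree_lt (hp.trans_lt hm),
        coeff_eq_zero_of_natDegree_lt (hN.le.trans_lt hm)]
      simp
  · intro i hi
    simp [h i hi, Lagrange.eval_nodal_at_node hi]

/-! ### Slack polynomials: points of the polar as polynomials -/

/-- The affine form `x ↦ 1 - ⟨y, x - c⟩` along the moment curve, as a polynomial in the
parameter. -/
noncomputable def slackPoly {d : ℕ} (c y : Fin d → ℝ) : ℝ[X] :=
  1 - ∑ k : Fin d, C (y k) * (X ^ (k.val + 1) - C (c k))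

/-- The affine extension to `ℝ^d` of evaluation of polynomials along the moment curve. -/
noncomputable def momentEval {d : ℕ} (x : Fin d → ℝ) (p : ℝ[X]) : ℝ :=
  p.coeff 0 + ∑ k : Fin d, p.coeff (k.val + 1) * x k

theorem eval_slackPoly {d : ℕ} (c y : Fin d → ℝ) (x : ℝ) :
    (slackPoly c y).eval x = 1 - dotProduct y (momentCurve d x - c) := by
  simp [slackPoly, dotProduct, momentCurve, eval_finsetSum]

theorem natDegree_slackPoly_le {d : ℕ} (c y : Fin d → ℝ) : (slackPoly c y).natDegree ≤ d := by
  refine (natDegree_sub_le _ _).trans (max_le (by simp) ?_)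
  refine natDegree_sum_le_of_forall_le _ _ fun k _ => ?_
  refine (natDegree_C_mul_le _ _).trans ?_
  rw [natDegree_X_pow_sub_C]
  exact k.2

theorem coeff_succ_slackPoly {d : ℕ} (c y : Fin d → ℝ) (k : Fin d) :
    (slackPoly c y).coeff (k.val + 1) = -y k := by
  simp [slackPoly, coeff_X_pow, coeff_one, Fin.val_inj]

theorem coeff_zero_slackPoly {d : ℕ} (c y : Fin d → ℝ) :
    (slackPoly c y).coeff 0 = 1 + dotProduct y c := by
  simp [slackPoly, dotProduct, coeff_X_pow, mul_comm]

theorem momentEval_slackPoly {d : ℕ} (c y x : Fin d → ℝ) :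
    momentEval x (slackPoly c y) = 1 - dotProduct y (x - c) := by
  simp [momentEval, coeff_zero_slackPoly, coeff_succ_slackPoly, dotProduct_sub]
  simp [dotProduct]; ring

theorem momentEval_center {d : ℕ} (c y : Fin d → ℝ) : momentEval c (slackPoly c y) = 1 := by
  simp [momentEval_slackPoly]

theorem momentEval_C_mul {d : ℕ} (x : Fin d → ℝ) (a : ℝ) (p : ℝ[X]) :
    momentEval x (C a * p) = a * momentEval x p := by
  simp [momentEval, mul_add, Finset.mul_sum, mul_assoc]

theorem momentEval_momentCurve {d : ℕ} (x : ℝ) {p : ℝ[X]} (hp : p.natDegree ≤ d) :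
    momentEval (momentCurve d x) p = p.eval x := by
  rw [eval_eq_sum_range' (Nat.lt_succ_of_le hp), Finset.sum_range_succ', ← Fin.sum_univ_eq_sum_range
    (fun k => p.coeff (k + 1) * x ^ (k + 1))]
  simp [momentEval, momentCurve, add_comm]

theorem slackPoly_injective {d : ℕ} (c : Fin d → ℝ) : Function.Injective (slackPoly c) := by
  intro y y' h
  ext k
  have := congrArg (fun p => p.coeff (k.val + 1)) h
  simpa [coeff_succ_slackPoly] using this

theorem exists_slackPoly_eq {d : ℕ} (c : Fin d → ℝ) {p : ℝ[X]} (hp : p.natDegree ≤ d)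
    (h1 : momentEval c p = 1) : ∃ y, slackPoly c y = p := by
  refine ⟨fun k => -p.coeff (k.val + 1), ?_⟩
  ext m
  rcases m with _ | m
  · rw [coeff_zero_slackPoly, ← h1]
    simp [momentEval, dotProduct]
  · by_cases hm : m < d
    · simpa using coeff_succ_slackPoly c (fun k => -p.coeff (k.val + 1)) ⟨m, hm⟩
    · rw [coeff_eq_zero_of_natDegree_lt ((natDegree_slackPoly_le _ _).trans_lt (by omega)),
        coeff_eq_zero_of_natDegree_lt (by omega)]

theorem slackPoly_lineMap {d : ℕ} (c y y' : Fin d → ℝ) {a b : ℝ} (hab : a + b = 1) :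
    slackPoly c (a • y + b • y') = C a * slackPoly c y + C b * slackPoly c y' := by
  ext m
  rcases m with _ | m
  · simp [coeff_zero_slackPoly]
    linear_combination -hab
  · by_cases hm : m < d
    · have h := fun z => coeff_succ_slackPoly c z ⟨m, hm⟩
      simp only at h
      simp [h]; ring
    · have h := fun z => coeff_eq_zero_of_natDegree_lt
        ((natDegree_slackPoly_le c z).trans_lt (by omega : d < m + 1))
      simp [h]

/-! ### The polar of a cyclic polytope -/

theorem forall_cyclicPolytope_momentEval_nonneg {d n : ℕ} {t : Fin n → ℝ} {p : ℝ[X]}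
    (hp : p.natDegree ≤ d) (h : ∀ i, 0 ≤ p.eval (t i)) :
    ∀ x ∈ cyclicPolytope d t, 0 ≤ momentEval x p := by
  have hconv : Convex ℝ {x : Fin d → ℝ | 0 ≤ momentEval x p} := by
    intro x hx y hy a b ha hb hab
    have hx : 0 ≤ momentEval x p := hx
    have hy : 0 ≤ momentEval y p := hy
    have : momentEval (a • x + b • y) p = a * momentEval x p + b * momentEval y p := by
      simp only [momentEval, Pi.add_apply, Pi.smul_apply, smul_eq_mul, mul_add, Finset.mul_sum,
        Finset.sum_add_distrib]
      rw [Finset.sum_congr rfl fun k _ => mul_left_comm (p.coeff (k.val + 1)) a (x k),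
        Finset.sum_congr rfl fun k _ => mul_left_comm (p.coeff (k.val + 1)) b (y k)]
      linear_combination (-p.coeff 0) * hab
    rw [Set.mem_ofPred_eq, this]
    positivity
  refine fun x hx => convexHull_min (t := {x : Fin d → ℝ | 0 ≤ momentEval x p}) ?_ hconv hx
  rintro _ ⟨i, rfl⟩
  rw [Set.mem_ofPred_eq, momentEval_momentCurve _ hp]
  exact h i

theorem momentCurve_mem_cyclicPolytope {d n : ℕ} (t : Fin n → ℝ) (i : Fin n) :
    momentCurve d (t i) ∈ cyclicPolytope d t := subset_convexHull _ _ ⟨i, rfl⟩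

theorem mem_polarPolytope_iff {d n : ℕ} {t : Fin n → ℝ} {c y : Fin d → ℝ} :
    y ∈ polarPolytope (cyclicPolytope d t) c ↔ ∀ i, 0 ≤ (slackPoly c y).eval (t i) := by
  constructor
  · intro h i
    rw [eval_slackPoly]
    linarith [h _ (momentCurve_mem_cyclicPolytope t i)]
  · intro h x hx
    have := forall_cyclicPolytope_momentEval_nonneg (natDegree_slackPoly_le c y) h x hx
    rw [momentEval_slackPoly] at this
    linarith

/-- A nonnegative affine form that vanishes at an interior point is zero: moving from `c` a little
against the gradient stays inside the polytope and would make the form negative. -/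
theorem momentEval_pos {d n : ℕ} {t : Fin n → ℝ} {c : Fin d → ℝ}
    (hc : c ∈ interior (cyclicPolytope d t)) {p : ℝ[X]} (hp : p.natDegree ≤ d)
    (h : ∀ i, 0 ≤ p.eval (t i)) (hp0 : p ≠ 0) : 0 < momentEval c p := by
  by_contra hneg
  rw [not_lt] at hneg
  have hP := forall_cyclicPolytope_momentEval_nonneg hp h
  have hc0 : 0 ≤ momentEval c p := hP c (interior_subset hc)
  set v : Fin d → ℝ := fun k => p.coeff (k.val + 1) with hv
  have hev : ∀ᶠ e : ℝ in nhdsWithin 0 (Set.Ioi 0), c - e • v ∈ cyclicPolytope d t := by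
    have hcont : Continuous fun e : ℝ => c - e • v := by fun_prop
    have : (fun e : ℝ => c - e • v) ⁻¹' (cyclicPolytope d t) ∈ nhds (0 : ℝ) :=
      hcont.continuousAt.preimage_mem_nhds (by simpa using mem_interior_iff_mem_nhds.1 hc)
    exact mem_nhdsWithin_of_mem_nhds this
  obtain ⟨e, he, he0⟩ := (hev.and self_mem_nhdsWithin).exists
  have he0 : 0 < e := he0
  have h1 := hP _ he
  have h2 : momentEval (c - e • v) p = momentEval c p - e * ∑ k, v k * v k := by
    simp only [momentEval, Pi.sub_apply, Pi.smul_apply, smul_eq_mul, mul_sub,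
      Finset.sum_sub_distrib, Finset.mul_sum, hv]
    rw [Finset.sum_congr rfl fun k _ => mul_left_comm (p.coeff (Fin.val k + 1)) e _]
    ring
  have h3 : 0 ≤ ∑ k, v k * v k := Finset.sum_nonneg fun k _ => mul_self_nonneg _
  have h4 : ∑ k, v k * v k = 0 := by
    by_contra hne
    have := mul_pos he0 (lt_of_le_of_ne h3 (Ne.symm hne))
    linarith
  rw [Finset.sum_eq_zero_iff_of_nonneg fun k _ => mul_self_nonneg _] at h4
  have h5 : ∀ k : Fin d, p.coeff (k.val + 1) = 0 := fun k => by
    simpa using h4 k (Finset.mem_univ k)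
  have h6 : p.coeff 0 = 0 := by
    have : momentEval c p = p.coeff 0 := by simp [momentEval, h5]
    linarith
  apply hp0
  ext m
  rcases m with _ | m
  · simpa using h6
  · by_cases hm : m < d
    · simpa using h5 ⟨m, hm⟩
    · rw [coeff_eq_zero_of_natDegree_lt (by omega)]; simp

/-- Dividing by the positive value at `c` normalizes `p`. Thus points of the polar can be
constructed by writing down polynomials. -/
theorem exists_mem_polarPolytope {d n : ℕ} {t : Fin n → ℝ} {c : Fin d → ℝ}
    (hc : c ∈ interior (cyclicPolytope d t)) {p : ℝ[X]} (hp : p.natDegree ≤ d)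
    (h : ∀ i, 0 ≤ p.eval (t i)) (hp0 : p ≠ 0) :
    ∃ y ∈ polarPolytope (cyclicPolytope d t) c, ∃ a > 0, slackPoly c y = C a * p := by
  have hpos := momentEval_pos hc hp h hp0
  obtain ⟨y, hy⟩ := exists_slackPoly_eq c (p := C (momentEval c p)⁻¹ * p)
    ((natDegree_C_mul_le _ _).trans hp) (by rw [momentEval_C_mul, inv_mul_cancel₀ hpos.ne'])
  refine ⟨y, mem_polarPolytope_iff.2 fun i => ?_, _, inv_pos.2 hpos, hy⟩
  rw [hy, eval_mul, eval_C]
  exact mul_nonneg (inv_pos.2 hpos).le (h i)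

theorem slackPoly_ne_zero {d : ℕ} (c y : Fin d → ℝ) : slackPoly c y ≠ 0 := by
  intro h
  have := momentEval_center c y
  rw [h] at this
  simp [momentEval] at this

theorem convex_polarPolytope {d : ℕ} (P : Set (Fin d → ℝ)) (c : Fin d → ℝ) :
    Convex ℝ (polarPolytope P c) := by
  intro x hx y hy a b ha hb hab z hz
  rw [add_dotProduct, smul_dotProduct, smul_dotProduct, smul_eq_mul, smul_eq_mul]
  nlinarith [mul_le_mul_of_nonneg_left (hx z hz) ha, mul_le_mul_of_nonneg_left (hy z hz) hb]

theorem isClosed_polarPolytope {d : ℕ} (P : Set (Fin d → ℝ)) (c : Fin d → ℝ) :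
    IsClosed (polarPolytope P c) := by
  have : polarPolytope P c = ⋂ x ∈ P, {y | dotProduct y (x - c) ≤ 1} := by
    ext y; simp [polarPolytope]
  rw [this]
  refine isClosed_biInter fun x _ => isClosed_le ?_ continuous_const
  simp only [dotProduct]
  fun_prop

theorem isCompact_polarPolytope {d : ℕ} {P : Set (Fin d → ℝ)} {c : Fin d → ℝ}
    (hc : c ∈ interior P) : IsCompact (polarPolytope P c) := by
  obtain ⟨e, he, hball⟩ := Metric.mem_nhds_iff.1 (mem_interior_iff_mem_nhds.1 hc)
  -- The points `c ± (e/2) e_k` lie in the ball inside `P`; testing against them bounds each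
  -- coordinate of `y` by `2/e`.
  have key : ∀ y ∈ polarPolytope P c, ∀ k, ∀ s : ℝ, |s| = e / 2 → y k * s ≤ 1 := by
    intro y hy k s hs
    have : c + Pi.single k s ∈ P := hball (by
      rw [Metric.mem_ball, dist_eq_norm, add_sub_cancel_left, Pi.norm_single, Real.norm_eq_abs, hs]
      linarith)
    simpa using hy _ this
  refine (isCompact_Icc (a := fun _ : Fin d => -(2 / e)) (b := fun _ => 2 / e)).of_isClosed_subset
    (isClosed_polarPolytope P c) fun y hy => ⟨fun k => ?_, fun k => ?_⟩
  · have := key y hy k (-(e / 2)) (by rw [abs_neg, abs_of_pos]; positivity)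
    show -(2 / e) ≤ y k
    rw [← neg_div, div_le_iff₀ he]; linarith
  · have := key y hy k (e / 2) (by rw [abs_of_pos]; positivity)
    show y k ≤ 2 / e
    rw [le_div_iff₀ he]; linarith

/-! ### Faces of the polar, given by supports of slack polynomials -/

/-- The set of indices `i` at which the slack of `y` is nonzero. -/
def slackSupport {d n : ℕ} (t : Fin n → ℝ) (c y : Fin d → ℝ) : Set (Fin n) :=
  {i | (slackPoly c y).eval (t i) ≠ 0}

/-- The face of the polar on which the slacks outside `Z` vanish. -/
def polarFace {d n : ℕ} (t : Fin n → ℝ) (c : Fin d → ℝ) (Z : Set (Fin n)) : Set (Fin d → ℝ) :=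
  {y ∈ polarPolytope (cyclicPolytope d t) c | slackSupport t c y ⊆ Z}

theorem eval_slackPoly_combo {d : ℕ} (c y y' : Fin d → ℝ) {a b : ℝ} (hab : a + b = 1) (x : ℝ) :
    (slackPoly c (a • y + b • y')).eval x
      = a * (slackPoly c y).eval x + b * (slackPoly c y').eval x := by
  rw [slackPoly_lineMap c y y' hab]; simp

theorem eval_slackPoly_eq_zero_of_mem_polarFace {d n : ℕ} {t : Fin n → ℝ} {c y : Fin d → ℝ}
    {Z : Set (Fin n)} (hy : y ∈ polarFace t c Z) {i : Fin n} (hi : i ∉ Z) :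
    (slackPoly c y).eval (t i) = 0 := by
  by_contra h
  exact hi (hy.2 h)

theorem isExposed_polarFace {d n : ℕ} (t : Fin n → ℝ) (c : Fin d → ℝ) (Z : Set (Fin n)) :
    IsExposed ℝ (polarPolytope (cyclicPolytope d t) c) (polarFace t c Z) := by
  classical
  rintro ⟨y0, hy0⟩
  set S : Finset (Fin n) := Finset.univ.filter (· ∉ Z) with hS
  -- Up to the constant `S.card`, this functional is minus the sum of the slacks over `S`, so on a
  -- nonempty face it is maximal exactly where all these slacks vanish.
  let l : (Fin d → ℝ) →ₗ[ℝ] ℝ :=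
    { toFun := fun y => ∑ i ∈ S, dotProduct y (momentCurve d (t i) - c)
      map_add' := fun y z => by simp only [add_dotProduct, Finset.sum_add_distrib]
      map_smul' := fun a y => by
        simp only [smul_dotProduct, Finset.mul_sum, smul_eq_mul, RingHom.id_apply] }
  have hl : ∀ y, l y = S.card - ∑ i ∈ S, (slackPoly c y).eval (t i) := by
    intro y
    simp [l, eval_slackPoly]
  have hmem : ∀ y ∈ polarFace t c Z, l y = S.card := by
    intro y hy
    rw [hl, Finset.sum_eq_zero, sub_zero]
    intro i hi
    exact eval_slackPoly_eq_zero_of_mem_polarFace hy (by simpa [hS] using hi)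
  have hle : ∀ y ∈ polarPolytope (cyclicPolytope d t) c, l y ≤ S.card := by
    intro y hy
    rw [hl]
    have := Finset.sum_nonneg fun i (_ : i ∈ S) => mem_polarPolytope_iff.1 hy i
    linarith
  refine ⟨l.toContinuousLinearMap, ?_⟩
  ext y
  constructor
  · intro hy
    refine ⟨hy.1, fun z hz => ?_⟩
    show l z ≤ l y
    rw [hmem y hy]; exact hle z hz
  · rintro ⟨hy, hmax⟩
    refine ⟨hy, fun i hi => ?_⟩
    by_contra hiZ
    have h1 : l y0 ≤ l y := hmax y0 hy0.1
    rw [hmem y0 hy0, hl] at h1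
    have h2 : ∑ i ∈ S, (slackPoly c y).eval (t i) ≤ 0 := by linarith
    have h3 := Finset.single_le_sum (f := fun i => (slackPoly c y).eval (t i))
      (fun i _ => mem_polarPolytope_iff.1 hy i) (show i ∈ S by simp [hS, hiZ])
    exact hi (le_antisymm (h3.trans h2) (mem_polarPolytope_iff.1 hy i))

theorem eventually_forall_slack_nonneg {n : ℕ} {a b : Fin n → ℝ} (ha : ∀ i, 0 ≤ a i)
    (hb : ∀ i, a i = 0 → b i = 0) :
    ∃ e > 0, ∀ i, 0 ≤ a i + e * b i ∧ 0 ≤ a i - e * b i := by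
  have hev : ∀ᶠ e : ℝ in nhdsWithin 0 (Set.Ioi 0), ∀ i, 0 ≤ a i + e * b i ∧ 0 ≤ a i - e * b i := by
    rw [Filter.eventually_all]
    intro i
    rcases (ha i).eq_or_lt with h | h
    · simp [← h, hb i h.symm]
    · have h1 : ∀ᶠ e : ℝ in nhds 0, 0 < a i + e * b i :=
        (by fun_prop : Continuous fun e : ℝ => a i + e * b i).continuousAt.eventually_const_lt
          (by simpa using h)
      have h2 : ∀ᶠ e : ℝ in nhds 0, 0 < a i - e * b i :=
        (by fun_prop : Continuous fun e : ℝ => a i - e * b i).continuousAt.eventually_const_lt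
          (by simpa using h)
      exact ((h1.and h2).mono fun e he => ⟨he.1.le, he.2.le⟩).filter_mono nhdsWithin_le_nhds
  obtain ⟨e, he, he0⟩ := (hev.and self_mem_nhdsWithin).exists
  exact ⟨e, he0, he⟩

/-- A nonempty face of the polar is determined by the support of one of its points. -/
theorem exists_eq_polarFace {d n : ℕ} {t : Fin n → ℝ} {c : Fin d → ℝ} {F : Set (Fin d → ℝ)}
    (hF : IsExposed ℝ (polarPolytope (cyclicPolytope d t) c) F) (hne : F.Nonempty) :
    ∃ y ∈ F, F = polarFace t c (slackSupport t c y) := by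
  classical
  -- Choose a point of largest support. The midpoint with any other point of `F` has the union of
  -- both supports, so every support lies in that of `y0`.
  obtain ⟨y0, hy0, hmin⟩ := (measure fun y => n - (slackSupport t c y).ncard).wf.has_min F hne
  have hsub : ∀ y ∈ F, slackSupport t c y ⊆ slackSupport t c y0 := by
    intro y hy
    have hab : (1 / 2 : ℝ) + 1 / 2 = 1 := by norm_num
    have hz : (1 / 2 : ℝ) • y0 + (1 / 2 : ℝ) • y ∈ F :=
      hF.convex (convex_polarPolytope _ _) hy0 hy (by norm_num) (by norm_num) hab
    have hsupp : slackSupport t c ((1 / 2 : ℝ) • y0 + (1 / 2 : ℝ) • y)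
        = slackSupport t c y0 ∪ slackSupport t c y := by
      ext i
      have h1 := mem_polarPolytope_iff.1 (hF.subset hy0) i
      have h2 := mem_polarPolytope_iff.1 (hF.subset hy) i
      simp only [slackSupport, Set.mem_ofPred_eq, Set.mem_union, eval_slackPoly_combo c y0 y hab]
      rw [← not_and_or, not_iff_not]
      constructor
      · intro h; constructor <;> linarith
      · rintro ⟨h, h'⟩; rw [h, h']; ring
    have h3 : ¬ (n - (slackSupport t c ((1 / 2 : ℝ) • y0 + (1 / 2 : ℝ) • y)).ncard
        < n - (slackSupport t c y0).ncard) := hmin _ hz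
    have hn : ∀ Z : Set (Fin n), Z.ncard ≤ n := fun Z => by
      simpa using Set.ncard_le_card Z
    rw [hsupp] at h3
    have h4 := hn (slackSupport t c y0 ∪ slackSupport t c y)
    have h5 := Set.eq_of_subset_of_ncard_le
      (Set.subset_union_left (s := slackSupport t c y0) (t := slackSupport t c y)) (by omega)
      (Set.toFinite _)
    rw [h5]; exact Set.subset_union_right
  refine ⟨y0, hy0, Set.Subset.antisymm (fun y hy => ⟨hF.subset hy, hsub y hy⟩) ?_⟩
  rintro y ⟨hy, hys⟩
  have hw0 := mem_polarPolytope_iff.1 (hF.subset hy0)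
  obtain ⟨e, he, hez⟩ := eventually_forall_slack_nonneg
    (a := fun i => (slackPoly c y0).eval (t i))
    (b := fun i => (slackPoly c y0).eval (t i) - (slackPoly c y).eval (t i)) hw0 (by
      intro i hi
      have : (slackPoly c y).eval (t i) = 0 := by
        by_contra h
        exact hys h hi
      rw [this, sub_zero]; exact hi)
  -- Prolong the segment from `y` slightly beyond `y0`; extremality of `F` at `y0` then forces `y ∈
  -- F`.
  have hab : (1 + e) + (-e) = 1 := by ring
  have hz : (1 + e) • y0 + (-e) • y ∈ polarPolytope (cyclicPolytope d t) c := by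
    rw [mem_polarPolytope_iff]
    intro i
    rw [eval_slackPoly_combo c y0 y hab]
    have := (hez i).1
    linarith
  have he1 : (1 + e) ≠ 0 := by positivity
  refine hF.isExtreme.left_mem_of_mem_openSegment hy hz hy0
    ⟨e / (1 + e), 1 / (1 + e), by positivity, by positivity, by field_simp; ring, ?_⟩
  ext k
  simp only [Pi.add_apply, Pi.smul_apply, smul_eq_mul]
  field_simp
  ring

/-! ### Vertices of the polar -/

open Classical in
/-- The indices at which the slack of `y` vanishes. -/
noncomputable def slackZeros {d n : ℕ} (t : Fin n → ℝ) (c y : Fin d → ℝ) : Finset (Fin n) :=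
  {i | (slackPoly c y).eval (t i) = 0}

theorem mem_slackZeros {d n : ℕ} {t : Fin n → ℝ} {c y : Fin d → ℝ} {i : Fin n} :
    i ∈ slackZeros t c y ↔ (slackPoly c y).eval (t i) = 0 := by simp [slackZeros]

theorem card_slackZeros_le {d n : ℕ} {t : Fin n → ℝ} (ht : StrictMono t) (c y : Fin d → ℝ) :
    (slackZeros t c y).card ≤ d := by
  by_contra h
  refine slackPoly_ne_zero c y (eq_zero_of_degree_lt_of_eval_index_eq_zero (v := t)
    (slackZeros t c y) ht.injective.injOn ?_ fun i hi => mem_slackZeros.1 hi)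
  exact (degree_le_of_natDegree_le (natDegree_slackPoly_le c y)).trans_lt
    (by exact_mod_cast not_le.1 h)

/-- With fewer than `d` vanishing slacks, some nonzero direction `v` preserves all of them, and `y ±
e v` stays in the polar for small `e`. -/
theorem card_slackZeros_of_mem_extremePoints {d n : ℕ} {t : Fin n → ℝ} (ht : StrictMono t)
    {c y : Fin d → ℝ} (hy : y ∈ (polarPolytope (cyclicPolytope d t) c).extremePoints ℝ) :
    (slackZeros t c y).card = d := by
  refine le_antisymm (card_slackZeros_le ht c y) ?_
  by_contra hlt
  let f : (Fin d → ℝ) →ₗ[ℝ] (slackZeros t c y → ℝ) :=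
    { toFun := fun v i => dotProduct v (momentCurve d (t i) - c)
      map_add' := fun y z => by ext; simp only [add_dotProduct, Pi.add_apply]
      map_smul' := fun a y => by ext; simp only [smul_dotProduct, Pi.smul_apply, RingHom.id_apply] }
  have hker : LinearMap.ker f ≠ ⊥ := LinearMap.ker_ne_bot_of_finrank_lt (by simpa using hlt)
  obtain ⟨v, hv, hv0⟩ := Submodule.exists_mem_ne_zero_of_ne_bot hker
  have hv' : ∀ i, (slackPoly c y).eval (t i) = 0 → dotProduct v (momentCurve d (t i) - c) = 0 := by
    intro i hi
    exact congrFun (LinearMap.mem_ker.1 hv) ⟨i, mem_slackZeros.2 hi⟩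
  obtain ⟨e, he, hez⟩ := eventually_forall_slack_nonneg
    (mem_polarPolytope_iff.1 hy.1) hv'
  have h1 : y + e • v ∈ polarPolytope (cyclicPolytope d t) c := by
    rw [mem_polarPolytope_iff]
    intro i
    have := (hez i).2
    rw [eval_slackPoly] at this ⊢
    rw [add_dotProduct, smul_dotProduct, smul_eq_mul]
    linarith
  have h2 : y - e • v ∈ polarPolytope (cyclicPolytope d t) c := by
    rw [mem_polarPolytope_iff]
    intro i
    have := (hez i).1
    rw [eval_slackPoly] at this ⊢
    rw [sub_dotProduct, smul_dotProduct, smul_eq_mul]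
    linarith
  have h3 := hy.2 h1 h2 ⟨1 / 2, 1 / 2, by norm_num, by norm_num, by norm_num, by
    ext k; simp; ring⟩
  have h4 : e • v = 0 := by simpa using h3
  rcases smul_eq_zero.1 h4 with h | h
  · exact he.ne' h
  · exact hv0 h

theorem slackPoly_eq_of_card {d n : ℕ} {t : Fin n → ℝ} (ht : StrictMono t)
    {c y : Fin d → ℝ} (hy : (slackZeros t c y).card = d) :
    slackPoly c y = C ((slackPoly c y).coeff d) * Lagrange.nodal (slackZeros t c y) t :=
  eq_smul_nodal ht hy (natDegree_slackPoly_le c y) fun _ hi => mem_slackZeros.1 hi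

/-- A polynomial of degree at most `d` that vanishes on the zeros of a vertex is a multiple of its
slack polynomial. -/
theorem eq_C_mul_slackPoly {d n : ℕ} {t : Fin n → ℝ} (ht : StrictMono t)
    {c y : Fin d → ℝ} (hy : (slackZeros t c y).card = d) {p : ℝ[X]} (hp : p.natDegree ≤ d)
    (h : ∀ i ∈ slackZeros t c y, p.eval (t i) = 0) :
    p = C (momentEval c p) * slackPoly c y := by
  have h1 := slackPoly_eq_of_card ht hy
  have h2 := eq_smul_nodal ht hy hp h
  have hne : (slackPoly c y).coeff d ≠ 0 := by
    intro h0
    rw [h0, C_0, zero_mul] at h1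
    exact slackPoly_ne_zero c y h1
  have h3 : p = C (p.coeff d / (slackPoly c y).coeff d) * slackPoly c y := by
    conv_rhs => rw [h1]
    rw [← mul_assoc, ← C_mul]
    simp only [coeff_C_mul]
    rw [show (Lagrange.nodal (slackZeros t c y) t).coeff d = 1 by
      have := (Lagrange.nodal_monic (s := slackZeros t c y) (v := t)).coeff_natDegree
      rwa [Lagrange.natDegree_nodal, hy] at this, mul_one, div_mul_cancel₀ _ hne]
    exact h2
  have h4 : momentEval c p = p.coeff d / (slackPoly c y).coeff d := by
    conv_lhs => rw [h3]
    rw [momentEval_C_mul, momentEval_center, mul_one]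
  rw [h4]; exact h3

theorem eq_of_slackZeros_subset {d n : ℕ} {t : Fin n → ℝ} (ht : StrictMono t)
    {c y z : Fin d → ℝ} (hy : (slackZeros t c y).card = d)
    (h : slackZeros t c y ⊆ slackZeros t c z) : z = y := by
  have h1 := eq_C_mul_slackPoly ht hy (natDegree_slackPoly_le c z)
    fun i hi => mem_slackZeros.1 (h hi)
  rw [momentEval_center, C_1, one_mul] at h1
  exact slackPoly_injective c h1

theorem slackZeros_subset_iff {d n : ℕ} {t : Fin n → ℝ} {c y z : Fin d → ℝ} :
    slackZeros t c y ⊆ slackZeros t c z ↔ slackSupport t c z ⊆ slackSupport t c y := by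
  constructor
  · intro h i hi hi'
    exact hi (mem_slackZeros.1 (h (mem_slackZeros.2 hi')))
  · intro h i hi
    rw [mem_slackZeros] at hi ⊢
    by_contra hi'
    exact h hi' hi

theorem polarFace_slackSupport_of_card {d n : ℕ} {t : Fin n → ℝ} (ht : StrictMono t)
    {c y : Fin d → ℝ} (hyP : y ∈ polarPolytope (cyclicPolytope d t) c)
    (hy : (slackZeros t c y).card = d) : polarFace t c (slackSupport t c y) = {y} := by
  ext z
  constructor
  · rintro ⟨-, hz⟩
    exact eq_of_slackZeros_subset ht hy (slackZeros_subset_iff.2 hz)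
  · rintro rfl
    exact ⟨hyP, subset_rfl⟩

/-! ### Lower facets and leading coefficients -/

/-- At a nonzero index `h` the slack is positive and equals the leading coefficient times a product
of sign `(-1)^k`, where `k` counts the zeros after `h` (Gale's evenness condition). -/
theorem coeff_pos_iff_even_card {d n : ℕ} {t : Fin n → ℝ} (ht : StrictMono t) {c y : Fin d → ℝ}
    (hyP : y ∈ polarPolytope (cyclicPolytope d t) c) (hy : (slackZeros t c y).card = d)
    {h : Fin n} (hh : h ∉ slackZeros t c y) :
    0 < (slackPoly c y).coeff d ↔ Even ((slackZeros t c y).filter (h < ·)).card := by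
  have h1 := sign_prod_sub ht h _ hh
  have h2 : 0 < (slackPoly c y).eval (t h) :=
    lt_of_le_of_ne (mem_polarPolytope_iff.1 hyP h) fun h0 => hh (mem_slackZeros.2 h0.symm)
  rw [slackPoly_eq_of_card ht hy, eval_mul, eval_C, Lagrange.eval_nodal] at h2
  rcases Nat.even_or_odd ((slackZeros t c y).filter (h < ·)).card with he | ho
  · rw [he.neg_one_pow, one_mul] at h1
    exact ⟨fun _ => he, fun _ => pos_of_mul_pos_left h2 h1.le⟩
  · rw [ho.neg_one_pow] at h1
    refine ⟨fun h3 => ?_, fun h3 => absurd h3 (Nat.not_even_iff_odd.2 ho)⟩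
    nlinarith

/-- The end-set is the part of `I` after the last hole that precedes some element of `I`. If there
is no such hole, the end-set is `I` itself, of even size `d`, and nothing of `I` follows a hole; `d
< n` provides a hole to test. -/
theorem even_card_endSet_iff {d n : ℕ} (hd : Even d) {I : Finset (Fin n)} (hI : I.card = d)
    {P : Prop} (hP : ∀ h ∉ I, (P ↔ Even (I.filter (h < ·)).card)) (hn : d < n) :
    Even (endSet I).card ↔ P := by
  classical
  by_cases hex : ∃ h, h ∉ I ∧ ∃ k ∈ I, h < k
  · obtain ⟨h, ⟨hh, k, hk, hhk⟩, hmax⟩ : ∃ h, (h ∉ I ∧ ∃ k ∈ I, h < k) ∧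
        ∀ h', (h' ∉ I ∧ ∃ k ∈ I, h' < k) → h' ≤ h := by
      have hne : (Finset.univ.filter fun h => h ∉ I ∧ ∃ k ∈ I, h < k).Nonempty := by
        obtain ⟨h, hh⟩ := hex
        exact ⟨h, Finset.mem_filter.2 ⟨Finset.mem_univ _, hh⟩⟩
      refine ⟨Finset.max' _ hne, (Finset.mem_filter.1 (Finset.max'_mem _ hne)).2, fun h' hh' => ?_⟩
      exact Finset.le_max' _ h' (Finset.mem_filter.2 ⟨Finset.mem_univ h', hh'⟩)
    have : endSet I = I.filter (h < ·) := by
      ext i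
      simp only [endSet, Finset.mem_filter]
      refine and_congr_right fun hi => ⟨fun hE => ?_, fun hlt j hij => ?_⟩
      · by_contra hle
        exact hh (hE h (not_lt.1 hle) ⟨k, hk, hhk.le⟩)
      · rintro ⟨k', hk', hjk⟩
        by_contra hj
        have : j < k' := lt_of_le_of_ne hjk (by rintro rfl; exact hj hk')
        exact absurd (hmax j ⟨hj, k', hk', this⟩) (not_le.2 (hlt.trans_le hij))
    rw [this, hP h hh]
  · push Not at hex
    have : endSet I = I := by
      ext i
      simp only [endSet, Finset.mem_filter, and_iff_left_iff_imp]
      rintro hi j hij ⟨k, hk, hjk⟩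
      by_contra hj
      have := hex j hj k hk
      exact hj (le_antisymm this hjk ▸ hk)
    obtain ⟨h, hh⟩ : ∃ h, h ∉ I := by
      by_contra hall
      push Not at hall
      have := Finset.card_le_card (show Finset.univ ⊆ I from fun i _ => hall i)
      simp at this
      omega
    rw [this, hP h hh, hI, Finset.filter_eq_empty_iff.2 fun k hk => not_lt.2 (hex h hh k hk)]
    simpa using hd

theorem indexSet_dualFace {d n : ℕ} (t : Fin n → ℝ) (c y : Fin d → ℝ) :
    indexSet d t (dualFace (cyclicPolytope d t) c y) = slackZeros t c y := by
  ext i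
  have h1 : i ∈ indexSet d t (dualFace (cyclicPolytope d t) c y) ↔
      momentCurve d (t i) ∈ dualFace (cyclicPolytope d t) c y := by simp [indexSet]
  rw [h1, mem_slackZeros, eval_slackPoly]
  constructor
  · intro h; linarith [h.2]
  · exact fun h => ⟨momentCurve_mem_cyclicPolytope t i, by linarith⟩

/-- An affine relation among points of the curve annihilates every polynomial of degree at most `d`;
the nodal polynomial of the other indices isolates one weight. -/
theorem affineIndependent_momentCurve {d n : ℕ} {t : Fin n → ℝ} (ht : StrictMono t)
    {I : Finset (Fin n)} (hI : I.card ≤ d + 1) :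
    AffineIndependent ℝ fun i : I => momentCurve d (t i) := by
  classical
  rw [affineIndependent_iff]
  intro S w hw0 hw i hi
  have hlin : ∀ p : ℝ[X], p.natDegree ≤ d → ∑ j ∈ S, w j * p.eval (t j) = 0 := by
    intro p hp
    have : ∀ j, w j * p.eval (t j) = w j * p.coeff 0
        + ∑ k : Fin d, p.coeff (k.val + 1) * (w j • momentCurve d (t j)) k := by
      intro j
      rw [← momentEval_momentCurve _ hp, momentEval, mul_add, Finset.mul_sum]
      congr 1
      refine Finset.sum_congr rfl fun k _ => ?_
      rw [Pi.smul_apply, smul_eq_mul]; ring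
    rw [Finset.sum_congr rfl fun j _ => this j, Finset.sum_add_distrib, ← Finset.sum_mul, hw0,
      zero_mul, zero_add, Finset.sum_comm]
    refine Finset.sum_eq_zero fun k _ => ?_
    rw [← Finset.mul_sum, ← Finset.sum_apply, hw, Pi.zero_apply, mul_zero]
  have h1 := hlin (Lagrange.nodal (I.erase i) t) (by
    rw [Lagrange.natDegree_nodal, Finset.card_erase_of_mem i.2]; omega)
  rw [Finset.sum_eq_single_of_mem i hi] at h1
  · refine (mul_eq_zero.1 h1).resolve_right ?_
    rw [Lagrange.eval_nodal]
    refine Finset.prod_ne_zero_iff.2 fun j hj => ?_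
    exact sub_ne_zero.2 fun h => (Finset.mem_erase.1 hj).1 (ht.injective h).symm
  · intro j _ hji
    rw [Lagrange.eval_nodal_at_node (Finset.mem_erase.2 ⟨fun h => hji (Subtype.ext h), j.2⟩),
      mul_zero]

theorem affineDim_of_nonempty_interior {d : ℕ} {P : Set (Fin d → ℝ)} (hP : (interior P).Nonempty) :
    affineDim P = d := by
  have hne : P ≠ ∅ := (hP.mono interior_subset).ne_empty
  have h1 : affineSpan ℝ (interior P) = ⊤ := isOpen_interior.affineSpan_eq_top hP
  have h2 : affineSpan ℝ P = ⊤ := top_le_iff.1 (h1 ▸ affineSpan_mono ℝ interior_subset)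
  rw [affineDim, if_neg hne, ← direction_affineSpan, h2, AffineSubspace.direction_top,
    finrank_top, Module.finrank_fin_fun]

theorem isFacet_dualFace {d n : ℕ} {t : Fin n → ℝ} (ht : StrictMono t) {c y : Fin d → ℝ}
    (hc : c ∈ interior (cyclicPolytope d t))
    (hyP : y ∈ polarPolytope (cyclicPolytope d t) c) (hy : (slackZeros t c y).card = d) :
    IsFacet (cyclicPolytope d t) (dualFace (cyclicPolytope d t) c y) := by
  classical
  let l : (Fin d → ℝ) →ₗ[ℝ] ℝ :=
    { toFun := fun x => dotProduct y x
      map_add' := fun _ _ => dotProduct_add _ _ _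
      map_smul' := fun _ _ => dotProduct_smul _ _ _ }
  have hl : ∀ x, dotProduct y (x - c) = l x - l c := fun x => dotProduct_sub _ _ _
  constructor
  · rintro ⟨x0, hx0⟩
    refine ⟨l.toContinuousLinearMap, ?_⟩
    ext x
    constructor
    · rintro ⟨hx, hx1⟩
      refine ⟨hx, fun z hz => ?_⟩
      show l z ≤ l x
      have := hyP z hz
      rw [hl] at this hx1
      linarith
    · rintro ⟨hx, hmax⟩
      have h1 : l x0 ≤ l x := hmax x0 hx0.1
      have h2 := hx0.2
      have h3 := hyP x hx
      refine ⟨hx, ?_⟩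
      rw [hl] at h2 h3 ⊢
      linarith
  · rw [affineDim_of_nonempty_interior ⟨c, hc⟩]
    have hsub : ∀ i ∈ slackZeros t c y, momentCurve d (t i) ∈ dualFace (cyclicPolytope d t) c y := by
      intro i hi
      rw [← indexSet_dualFace] at hi
      simpa [indexSet] using hi
    rcases Nat.eq_zero_or_pos d with rfl | hd
    · have : dualFace (cyclicPolytope 0 t) c y = ∅ := by
        rw [Set.eq_empty_iff_forall_notMem]
        rintro x ⟨-, hx⟩
        simp [dotProduct] at hx
      rw [this, affineDim, if_pos rfl]
      norm_num
    · obtain ⟨i0, hi0⟩ := Finset.card_pos.1 (hy ▸ hd)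
      have hne : dualFace (cyclicPolytope d t) c y ≠ ∅ :=
        Set.nonempty_iff_ne_empty.1 ⟨_, hsub i0 hi0⟩
      rw [affineDim, if_neg hne]
      have hlow : d - 1 ≤ Module.finrank ℝ (vectorSpan ℝ (dualFace (cyclicPolytope d t) c y)) := by
        rw [← (affineIndependent_momentCurve ht (d := d) (I := slackZeros t c y)
          (by omega)).finrank_vectorSpan (n := d - 1) (by simp [hy]; omega)]
        refine Submodule.finrank_mono (vectorSpan_mono ℝ ?_)
        rintro _ ⟨i, rfl⟩
        exact hsub i i.2
      have hupp : Module.finrank ℝ (vectorSpan ℝ (dualFace (cyclicPolytope d t) c y)) < d := by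
        have h1 : vectorSpan ℝ (dualFace (cyclicPolytope d t) c y) ≤ LinearMap.ker l := by
          rw [vectorSpan, Submodule.span_le]
          rintro _ ⟨x, hx, z, hz, rfl⟩
          have h2 := hx.2
          have h3 := hz.2
          rw [hl] at h2 h3
          show l (x - z) = 0
          rw [map_sub]; linarith
        have h2 : LinearMap.ker l ≠ ⊤ := by
          intro htop
          have h3 : ∀ x, l x = 0 := fun x => by
            rw [← LinearMap.mem_ker, htop]; trivial
          have h4 := (hsub i0 hi0).2
          rw [hl, h3, h3] at h4
          norm_num at h4
        have h3 := Submodule.finrank_lt h2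
        rw [Module.finrank_fin_fun] at h3
        exact (Submodule.finrank_mono h1).trans_lt h3
      omega

theorem mem_extremePoints_of_card {d n : ℕ} {t : Fin n → ℝ} (ht : StrictMono t) {c y : Fin d → ℝ}
    (hyP : y ∈ polarPolytope (cyclicPolytope d t) c) (hy : (slackZeros t c y).card = d) :
    y ∈ (polarPolytope (cyclicPolytope d t) c).extremePoints ℝ := by
  have := isExposed_polarFace t c (slackSupport t c y)
  rw [polarFace_slackSupport_of_card ht hyP hy] at this
  exact isExtreme_singleton.1 this.isExtreme

theorem mem_lowerDualVertices_iff {d n : ℕ} (hd : Even d) (hn : d < n) {t : Fin n → ℝ}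
    (ht : StrictMono t) {c : Fin d → ℝ} (hc : c ∈ interior (cyclicPolytope d t)) {y : Fin d → ℝ} :
    y ∈ lowerDualVertices d t c ↔ y ∈ polarPolytope (cyclicPolytope d t) c ∧
      (slackZeros t c y).card = d ∧ 0 < (slackPoly c y).coeff d := by
  have key : y ∈ polarPolytope (cyclicPolytope d t) c → (slackZeros t c y).card = d →
      (Even (endSet (indexSet d t (dualFace (cyclicPolytope d t) c y))).card ↔
        0 < (slackPoly c y).coeff d) := by
    intro hyP hy
    rw [indexSet_dualFace]
    exact even_card_endSet_iff hd hy (fun h hh => coeff_pos_iff_even_card ht hyP hy hh) hn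
  constructor
  · rintro ⟨hy, hlow⟩
    have hcard := card_slackZeros_of_mem_extremePoints ht hy
    exact ⟨hy.1, hcard, (key hy.1 hcard).1 hlow.2⟩
  · rintro ⟨hyP, hcard, hpos⟩
    exact ⟨mem_extremePoints_of_card ht hyP hcard, isFacet_dualFace ht hc hyP hcard,
      (key hyP hcard).2 hpos⟩

/-- The leading coefficient is affine in `y` (minus the last coordinate, or the constant `1` for `d
= 0`), so its minimum over a compact set is attained at an extreme point. -/
theorem exists_extremePoint_coeff_le {d : ℕ} (c : Fin d → ℝ) {F : Set (Fin d → ℝ)}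
    (hF : IsCompact F) {z : Fin d → ℝ} (hz : z ∈ F) :
    ∃ y ∈ F.extremePoints ℝ, (slackPoly c y).coeff d ≤ (slackPoly c z).coeff d := by
  rcases Nat.eq_zero_or_pos d with rfl | hd
  · obtain ⟨y, hy⟩ := hF.extremePoints_nonempty ⟨z, hz⟩
    exact ⟨y, hy, by simp [coeff_zero_slackPoly, dotProduct]⟩
  · have hcoeff : ∀ y, (slackPoly c y).coeff d = -y ⟨d - 1, by omega⟩ := by
      intro y
      rw [← coeff_succ_slackPoly c y ⟨d - 1, by omega⟩]
      congr 1; simp; omega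
    obtain ⟨m, hm, hmax⟩ := hF.exists_isMaxOn ⟨z, hz⟩
      (continuous_apply (⟨d - 1, by omega⟩ : Fin d)).continuousOn
    set l : StrongDual ℝ (Fin d → ℝ) := ContinuousLinearMap.proj ⟨d - 1, by omega⟩
    have hexp : IsExposed ℝ F (l.toExposed F) := ContinuousLinearMap.toExposed.isExposed
    obtain ⟨y, hy⟩ := (hexp.isCompact hF).extremePoints_nonempty ⟨m, hm, fun x hx => hmax hx⟩
    refine ⟨y, hexp.isExtreme.extremePoints_subset_extremePoints hy, ?_⟩
    rw [hcoeff, hcoeff]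
    have : l z ≤ l y := hy.1.2 z hz
    exact neg_le_neg this

/-- Positivity of an affine function on a compact face can be tested at its vertices; this turns the
condition on lower facets into one on polynomials. -/
theorem mem_lowerPolarComplex_iff {d n : ℕ} (hd : Even d) (hn : d < n) {t : Fin n → ℝ}
    (ht : StrictMono t) {c : Fin d → ℝ} (hc : c ∈ interior (cyclicPolytope d t))
    {F : Set (Fin d → ℝ)} :
    F ∈ lowerPolarComplex d t c ↔ IsExposed ℝ (polarPolytope (cyclicPolytope d t) c) F ∧
      F.Nonempty ∧ ∀ y ∈ F, 0 < (slackPoly c y).coeff d := by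
  refine and_congr_right fun hF => and_congr_right fun _ => ⟨fun h y hy => ?_, fun h y hy => ?_⟩
  · obtain ⟨z, hz, hzy⟩ :=
      exists_extremePoint_coeff_le c (hF.isCompact (isCompact_polarPolytope hc)) hy
    exact ((mem_lowerDualVertices_iff hd hn ht hc).1 (h hz)).2.2.trans_le hzy
  · have := hF.isExtreme.extremePoints_subset_extremePoints hy
    exact (mem_lowerDualVertices_iff hd hn ht hc).2
      ⟨this.1, card_slackZeros_of_mem_extremePoints ht this, h y hy.1⟩

/-- Directions of `F` are killed by the `J`-slacks. The `d` zeros of `y` determine `y`, so such a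
direction is determined by its values at the remaining `d - J.card` zeros. -/
theorem finrank_vectorSpan_add_card_le {d n : ℕ} {t : Fin n → ℝ} (ht : StrictMono t)
    {c y : Fin d → ℝ} {F : Set (Fin d → ℝ)} (hyF : y ∈ F) (hy : (slackZeros t c y).card = d)
    {J : Finset (Fin n)} (hJ : ∀ z ∈ F, J ⊆ slackZeros t c z) :
    Module.finrank ℝ (vectorSpan ℝ F) + J.card ≤ d := by
  classical
  have hkill : ∀ v ∈ vectorSpan ℝ F, ∀ j ∈ J, dotProduct v (momentCurve d (t j) - c) = 0 := by
    intro v hv j hj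
    rw [vectorSpan] at hv
    induction hv using Submodule.span_induction with
    | mem x hx =>
      obtain ⟨a, ha, b, hb, rfl⟩ := hx
      have h1 := mem_slackZeros.1 (hJ a ha hj)
      have h2 := mem_slackZeros.1 (hJ b hb hj)
      rw [eval_slackPoly] at h1 h2
      show dotProduct (a - b) _ = 0
      rw [sub_dotProduct]; linarith
    | zero => simp
    | add x z _ _ hx hz => rw [add_dotProduct, hx, hz, add_zero]
    | smul a x _ hx => rw [smul_dotProduct, hx, smul_zero]
  let f : vectorSpan ℝ F →ₗ[ℝ] ((slackZeros t c y \ J : Finset (Fin n)) → ℝ) :=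
    { toFun := fun v i => dotProduct v.1 (momentCurve d (t i) - c)
      map_add' := fun y z => by ext; simp only [Submodule.coe_add, add_dotProduct, Pi.add_apply]
      map_smul' := fun a y => by
        ext; simp only [Submodule.coe_smul, smul_dotProduct, Pi.smul_apply, RingHom.id_apply] }
  have hf : Function.Injective f := by
    rw [← LinearMap.ker_eq_bot, LinearMap.ker_eq_bot']
    intro v hv
    have : y + v.1 = y := by
      refine eq_of_slackZeros_subset ht hy fun i hi => ?_
      have h0 : dotProduct v.1 (momentCurve d (t i) - c) = 0 := by
        by_cases hiJ : i ∈ J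
        · exact hkill v v.2 i hiJ
        · exact congrFun hv ⟨i, Finset.mem_sdiff.2 ⟨hi, hiJ⟩⟩
      rw [mem_slackZeros, eval_slackPoly] at hi ⊢
      rw [add_dotProduct, h0]
      linarith
    exact Subtype.ext (by simpa using this)
  have h1 := LinearMap.finrank_le_finrank_of_injective hf
  rw [Module.finrank_fintype_fun_eq_card, Fintype.card_coe,
    Finset.card_sdiff_of_subset (hJ y hyF), hy] at h1
  have := Finset.card_le_card (hJ y hyF)
  omega

end SlackPolynomials

/-! ### Row-covering chains and monotone maps -/

/-- Chains in the grid `[r] × [s]` that meet every row. -/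
abbrev RowCoveringChain (r s : ℕ) : Type :=
  {l : Finset (Fin r × Fin s) // IsChain (· ≤ ·) (l : Set (Fin r × Fin s)) ∧ ∀ i, ∃ j, (i, j) ∈ l}

namespace RowCoveringChain

variable {r s : ℕ}

theorem snd_le (l : RowCoveringChain r s) {x y : Fin r × Fin s} (hx : x ∈ l.1) (hy : y ∈ l.1)
    (h : x.1 < y.1) : x.2 ≤ y.2 := by
  have hne : x ≠ y := by rintro rfl; exact lt_irrefl _ h
  rcases l.2.1 hx hy hne with h' | h'
  · exact h'.2
  · exact absurd h'.1 (not_le.2 h)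

theorem fst_le (l : RowCoveringChain r s) {x y : Fin r × Fin s} (hx : x ∈ l.1) (hy : y ∈ l.1)
    (h : x.2 < y.2) : x.1 ≤ y.1 :=
  not_lt.1 fun h' => absurd (l.snd_le hy hx h') (not_le.2 h)

/-- Any choice of one point per row of a chain is monotone, so `(i, j)` can be prescribed. Hence a
row-covering chain is the union of the graphs inside it. -/
theorem exists_monotone_mem (l : RowCoveringChain r s) {i : Fin r} {j : Fin s} (h : (i, j) ∈ l.1) :
    ∃ f : Fin r →o Fin s, f i = j ∧ ∀ k, (k, f k) ∈ l.1 := by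
  choose g hg using l.2.2
  have hmem : ∀ k, (k, Function.update g i j k) ∈ l.1 := by
    intro k
    by_cases hk : k = i
    · subst hk; simpa using h
    · simpa [hk] using hg k
  refine ⟨⟨Function.update g i j, fun a b hab => ?_⟩, Function.update_self _ _ _, hmem⟩
  rcases hab.eq_or_lt with rfl | hab
  · rfl
  · exact l.snd_le (hmem a) (hmem b) hab

/-- The union of the graphs of two monotone maps that differ in at most one row. -/
def ofPair (f g : Fin r →o Fin s) {i₀ : Fin r} (h : ∀ i, i ≠ i₀ → f i = g i) :
    RowCoveringChain r s :=
  ⟨Finset.univ.filter fun x => x.2 = f x.1 ∨ x.2 = g x.1, by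
    have key : ∀ x y : Fin r × Fin s, x.1 < y.1 → (x.2 = f x.1 ∨ x.2 = g x.1) →
        (y.2 = f y.1 ∨ y.2 = g y.1) → x ≤ y := by
      intro x y hxy hx hy
      refine ⟨hxy.le, ?_⟩
      have hf := f.monotone hxy.le
      have hg := g.monotone hxy.le
      by_cases h1 : x.1 = i₀
      · have h2 := h y.1 (by rw [← h1]; exact hxy.ne')
        rw [h2, or_self] at hy
        rcases hx with hx | hx
        · rw [hx, hy, ← h2]; exact hf
        · rw [hx, hy]; exact hg
      · have h2 := h x.1 h1
        rw [h2, or_self] at hx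
        rcases hy with hy | hy
        · rw [hx, hy, ← h2]; exact hf
        · rw [hx, hy]; exact hg
    constructor
    · intro x hx y hy hxy
      simp only [Finset.coe_filter, Finset.mem_univ, true_and, Set.mem_ofPred_eq] at hx hy
      rcases lt_trichotomy x.1 y.1 with h1 | h1 | h1
      · exact Or.inl (key x y h1 hx hy)
      · rcases le_total x.2 y.2 with h2 | h2
        · exact Or.inl ⟨h1.le, h2⟩
        · exact Or.inr ⟨h1.ge, h2⟩
      · exact Or.inr (key y x h1 hy hx)
    · intro i
      exact ⟨f i, by simp⟩⟩

theorem mem_ofPair {f g : Fin r →o Fin s} {i₀ : Fin r} {h : ∀ i, i ≠ i₀ → f i = g i}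
    {x : Fin r × Fin s} : x ∈ (ofPair f g h).1 ↔ x.2 = f x.1 ∨ x.2 = g x.1 := by
  simp [ofPair]

/-- The graph of a monotone map. -/
def graph (f : Fin r →o Fin s) : RowCoveringChain r s :=
  ⟨Finset.univ.filter fun x => x.2 = f x.1, by
    constructor
    · intro x hx y hy _
      simp only [Finset.coe_filter, Finset.mem_univ, true_and, Set.mem_ofPred_eq] at hx hy
      rcases le_total x.1 y.1 with h | h
      · exact Or.inl ⟨h, by rw [hx, hy]; exact f.monotone h⟩
      · exact Or.inr ⟨h, by rw [hx, hy]; exact f.monotone h⟩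
    · intro i
      exact ⟨f i, by simp⟩⟩

theorem mem_graph {f : Fin r →o Fin s} {x : Fin r × Fin s} : x ∈ (graph f).1 ↔ x.2 = f x.1 := by
  simp [graph]

theorem graph_le_iff {f : Fin r →o Fin s} {l : RowCoveringChain r s} :
    graph f ≤ l ↔ ∀ i, (i, f i) ∈ l.1 := by
  constructor
  · exact fun h i => h (mem_graph.2 rfl)
  · rintro h ⟨i, j⟩ hij
    obtain rfl : j = f i := mem_graph.1 hij
    exact h i

end RowCoveringChain


/-! ### Weak compositions as monotone maps -/

/-- The fibre sizes of a map `[r] → [s]`, as a weak composition of `r`. -/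
def fiberComposition {r s : ℕ} (f : Fin r →o Fin s) : WeakComposition r s :=
  ⟨fun k => (Finset.univ.filter fun i => f i = k).card, by
    have := Finset.card_eq_sum_card_fiberwise (f := f) (s := Finset.univ) (t := Finset.univ)
      (fun _ _ => Finset.mem_coe.2 (Finset.mem_univ _))
    simpa using this.symm⟩

theorem fiberComposition_apply {r s : ℕ} (f : Fin r →o Fin s) (k : Fin s) :
    (fiberComposition f).1 k = (Finset.univ.filter fun i => f i = k).card := rfl

theorem count_ofFn_eq {r s : ℕ} (f : Fin r →o Fin s) (k : Fin s) :
    (List.ofFn f : Multiset (Fin s)).count k = (fiberComposition f).1 k := by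
  rw [← Fin.univ_val_map, Multiset.count_map, fiberComposition]
  simp only [Finset.card, Finset.filter_val]
  congr 2
  ext i; exact eq_comm

/-- A monotone map is a sorted list of values, determined by its multiset, and the fibre sizes are
the multiplicities. -/
theorem fiberComposition_injective {r s : ℕ} :
    Function.Injective (fiberComposition (r := r) (s := s)) := by
  intro f g h
  have h1 : (List.ofFn f : Multiset (Fin s)) = List.ofFn g := by
    ext k
    rw [count_ofFn_eq, count_ofFn_eq, h]
  have h2 := (Multiset.coe_eq_coe.1 h1).eq_of_sortedLE f.monotone.sortedLE_ofFn
    g.monotone.sortedLE_ofFn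
  exact OrderHom.ext _ _ (List.ofFn_injective h2)

theorem fiberComposition_surjective {r s : ℕ} :
    Function.Surjective (fiberComposition (r := r) (s := s)) := by
  intro a
  set m : Multiset (Fin s) := ∑ k, a.1 k • {k} with hm
  have hcard : (m.sort).length = r := by
    rw [Multiset.length_sort, hm, Multiset.card_sum]
    simpa using a.2
  have hsort : (m.sort).SortedLE := (Multiset.pairwise_sort m (· ≤ ·)).sortedLE
  refine ⟨⟨fun i => m.sort.get (i.cast hcard.symm), fun i j hij => hsort.monotone_get hij⟩, ?_⟩
  refine Subtype.ext (funext fun k => ?_)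
  rw [← count_ofFn_eq]
  have : List.ofFn (fun i : Fin r => m.sort.get (i.cast hcard.symm)) = m.sort := by
    refine List.ext_get (by simp [hcard]) fun i h1 h2 => ?_
    simp
  show Multiset.count k (List.ofFn (fun i : Fin r => m.sort.get (i.cast hcard.symm))) = a.1 k
  rw [this, Multiset.sort_eq, hm, Multiset.count_sum']
  simp [Multiset.count_singleton]

theorem fiberComposition_of_differ {r s : ℕ} {f g : Fin r →o Fin s} {i₀ : Fin r}
    (h : ∀ i, i ≠ i₀ → f i = g i) (hlt : f i₀ < g i₀) :
    (∀ k, k ≠ f i₀ → k ≠ g i₀ → (fiberComposition f).1 k = (fiberComposition g).1 k) ∧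
    (fiberComposition f).1 (f i₀) = (fiberComposition g).1 (f i₀) + 1 ∧
    (fiberComposition g).1 (g i₀) = (fiberComposition f).1 (g i₀) + 1 := by
  refine ⟨fun k hk hk' => ?_, ?_, ?_⟩
  · rw [fiberComposition_apply, fiberComposition_apply]
    congr 1
    ext i
    simp only [Finset.mem_filter, Finset.mem_univ, true_and]
    by_cases hi : i = i₀
    · subst hi; exact ⟨fun h => absurd h.symm hk, fun h => absurd h.symm hk'⟩
    · rw [h i hi]
  · rw [fiberComposition_apply, fiberComposition_apply]
    rw [← Finset.card_insert_of_notMem (a := i₀) (by simpa using hlt.ne')]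
    congr 1
    ext i
    simp only [Finset.mem_filter, Finset.mem_univ, true_and, Finset.mem_insert]
    by_cases hi : i = i₀
    · subst hi; simp
    · rw [h i hi]; simp [hi]
  · rw [fiberComposition_apply, fiberComposition_apply]
    rw [← Finset.card_insert_of_notMem (a := i₀) (by simpa using hlt.ne)]
    congr 1
    ext i
    simp only [Finset.mem_filter, Finset.mem_univ, true_and, Finset.mem_insert]
    by_cases hi : i = i₀
    · subst hi; simp
    · rw [h i hi]; simp [hi]

/-- By monotonicity, rows before `i₀` take values at most `f i₀` and rows after it take values at
least `g i₀`, so the fibres strictly between are empty. -/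
theorem adj_of_differ {r s : ℕ} {f g : Fin r →o Fin s} {i₀ : Fin r}
    (h : ∀ i, i ≠ i₀ → f i = g i) (hlt : f i₀ < g i₀) :
    (compositionGraph r s).Adj (fiberComposition f) (fiberComposition g) := by
  obtain ⟨h1, h2, h3⟩ := fiberComposition_of_differ h hlt
  refine ⟨f i₀, g i₀, hlt, h1, fun k hk hk' => ?_, Or.inl ⟨h2, h3⟩⟩
  rw [fiberComposition_apply, Finset.card_eq_zero, Finset.filter_eq_empty_iff]
  rintro i - rfl
  rcases lt_trichotomy i i₀ with hi | hi | hi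
  · exact absurd (f.monotone hi.le) (not_le.2 hk)
  · subst hi; exact lt_irrefl _ hk
  · rw [h i hi.ne'] at hk'
    exact absurd (g.monotone hi.le) (not_le.2 hk')

/-- Raise the last row of the fibre over `i` to the value `j`. The empty fibres in between keep the
map monotone, and the result has the fibre sizes of `g`, hence is `g`. -/
theorem differ_of_move {r s : ℕ} {f g : Fin r →o Fin s} {i j : Fin s} (hij : i < j)
    (h : ∀ k, k ≠ i → k ≠ j → (fiberComposition f).1 k = (fiberComposition g).1 k)
    (h0 : ∀ k, i < k → k < j → (fiberComposition f).1 k = 0)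
    (hi : (fiberComposition f).1 i = (fiberComposition g).1 i + 1)
    (hj : (fiberComposition g).1 j = (fiberComposition f).1 j + 1) :
    ∃ i₀, ∀ m, m ≠ i₀ → f m = g m := by
  have hne : (Finset.univ.filter fun m => f m = i).Nonempty :=
    Finset.card_pos.1 (by show 0 < (fiberComposition f).1 i; omega)
  set i₀ := Finset.max' _ hne with hi₀
  have hfi : f i₀ = i := (Finset.mem_filter.1 (Finset.max'_mem _ hne)).2
  have hafter : ∀ m, i₀ < m → j ≤ f m := by
    intro m hm
    have h1 : i ≤ f m := hfi ▸ f.monotone hm.le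
    have h2 : f m ≠ i := fun h2 =>
      absurd (Finset.le_max' _ m (Finset.mem_filter.2 ⟨Finset.mem_univ m, h2⟩)) (not_le.2 hm)
    by_contra hlt
    have h3 := h0 (f m) (lt_of_le_of_ne h1 h2.symm) (not_le.1 hlt)
    rw [fiberComposition_apply, Finset.card_eq_zero, Finset.filter_eq_empty_iff] at h3
    exact h3 (Finset.mem_univ m) rfl
  let f' : Fin r →o Fin s := ⟨Function.update f i₀ j, by
    intro a b hab
    by_cases ha : a = i₀ <;> by_cases hb : b = i₀
    · rw [ha, hb]
    · rw [ha, Function.update_self, Function.update_of_ne hb]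
      exact hafter b (lt_of_le_of_ne (ha ▸ hab) (Ne.symm hb))
    · rw [hb, Function.update_self, Function.update_of_ne ha]
      exact (hfi ▸ f.monotone (hb ▸ hab) : f a ≤ i).trans hij.le
    · rw [Function.update_of_ne ha, Function.update_of_ne hb]
      exact f.monotone hab⟩
  have hf' : ∀ m, m ≠ i₀ → f m = f' m := fun m hm => (Function.update_of_ne hm _ _).symm
  have hf'i : f' i₀ = j := Function.update_self _ _ _
  obtain ⟨h1, h2, h3⟩ := fiberComposition_of_differ hf' (by rw [hfi, hf'i]; exact hij)
  rw [hfi, hf'i] at h1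
  rw [hfi] at h2
  rw [hf'i] at h3
  have : f' = g := fiberComposition_injective (Subtype.ext (funext fun k => by
    by_cases hki : k = i
    · subst hki; omega
    · by_cases hkj : k = j
      · subst hkj; omega
      · rw [← h1 k hki hkj, h k hki hkj]))
  exact ⟨i₀, fun m hm => by rw [hf' m hm, this]⟩

theorem adj_fiberComposition_iff {r s : ℕ} {f g : Fin r →o Fin s} :
    (compositionGraph r s).Adj (fiberComposition f) (fiberComposition g) ↔
      f ≠ g ∧ ∃ i₀, ∀ i, i ≠ i₀ → f i = g i := by
  constructor
  · intro hadj
    refine ⟨fun h => hadj.ne (by rw [h]), ?_⟩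
    obtain ⟨i, j, hij, h, h0, h1 | h1⟩ := hadj
    · exact differ_of_move hij h h0 h1.1 h1.2
    · obtain ⟨i₀, hi₀⟩ := differ_of_move hij (fun k hk hk' => (h k hk hk').symm)
        (fun k hk hk' => by rw [← h k hk.ne' hk'.ne]; exact h0 k hk hk') h1.1 h1.2
      exact ⟨i₀, fun m hm => (hi₀ m hm).symm⟩
  · rintro ⟨hne, i₀, h⟩
    rcases lt_trichotomy (f i₀) (g i₀) with hlt | heq | hlt
    · exact adj_of_differ h hlt
    · refine absurd (OrderHom.ext _ _ (funext fun i => ?_)) hne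
      by_cases hi : i = i₀
      · rw [hi, heq]
      · exact h i hi
    · exact (adj_of_differ (fun i hi => (h i hi).symm) hlt).symm

/-! ### The chain model, its realization by the staircase slice, and the index combinatorics -/

section ChainComplexes

open RowCoveringChain

/-! ### Complexes modelled on row-covering chains -/

/-- The cells in `K` are parametrized by the row-covering chains, with vertices `v f` given by
monotone maps. -/
structure IsChainComplex {r s : ℕ} {E : Type*} [AddCommGroup E] [Module ℝ E] (K : Set (Set E))
    (cell : RowCoveringChain r s → Set E) (v : (Fin r →o Fin s) → E) : Prop where
  cell_mem : ∀ l, cell l ∈ K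
  exists_cell : ∀ C ∈ K, ∃ l, cell l = C
  mono : ∀ l l', l ≤ l' → cell l ⊆ cell l'
  convex : ∀ l, Convex ℝ (cell l)
  vertex_mem_iff : ∀ f l, v f ∈ cell l ↔ graph f ≤ l
  cell_graph : ∀ f, cell (graph f) = {v f}
  extreme : ∀ f l, graph f ≤ l → v f ∈ (cell l).extremePoints ℝ
  edge : ∀ (f g : Fin r →o Fin s) (i₀ : Fin r) (h : ∀ i, i ≠ i₀ → f i = g i),
    cell (ofPair f g h) ⊆ segment ℝ (v f) (v g)

namespace IsChainComplex

variable {r s : ℕ} {E : Type*} [AddCommGroup E] [Module ℝ E] {K : Set (Set E)}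
  {cell : RowCoveringChain r s → Set E} {v : (Fin r →o Fin s) → E}

/-- Every point of a chain lies on a graph contained in it, so the vertices in a cell recover its
chain. -/
theorem cell_subset_iff (hK : IsChainComplex K cell v) {l l' : RowCoveringChain r s} :
    cell l ⊆ cell l' ↔ l ≤ l' := by
  refine ⟨fun h => ?_, hK.mono l l'⟩
  rintro ⟨i, j⟩ hij
  obtain ⟨f, rfl, hf⟩ := l.exists_monotone_mem hij
  exact graph_le_iff.1 ((hK.vertex_mem_iff f l').1
    (h ((hK.vertex_mem_iff f l).2 (graph_le_iff.2 hf)))) i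

/-- The face poset is the poset of row-covering chains. -/
noncomputable def orderIso (hK : IsChainComplex K cell v) : RowCoveringChain r s ≃o K where
  toEquiv := Equiv.ofBijective (fun l => ⟨cell l, hK.cell_mem l⟩)
    ⟨fun l l' h => by
      have h := congrArg Subtype.val h
      exact le_antisymm (hK.cell_subset_iff.1 h.subset) (hK.cell_subset_iff.1 h.superset),
    fun C => by
      obtain ⟨l, hl⟩ := hK.exists_cell C.1 C.2
      exact ⟨l, Subtype.ext hl⟩⟩
  map_rel_iff' := hK.cell_subset_iff

theorem vertex_injective (hK : IsChainComplex K cell v) : Function.Injective v := by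
  intro f g h
  have h1 : v f ∈ cell (graph g) := by rw [hK.cell_graph, h]; rfl
  rw [hK.vertex_mem_iff, graph_le_iff] at h1
  exact OrderHom.ext _ _ (funext fun i => mem_graph.1 (h1 i))

theorem exists_vertex_eq (hK : IsChainComplex K cell v) (hr : 1 ≤ r) {p : E} (hp : {p} ∈ K) :
    ∃ f, v f = p := by
  obtain ⟨l, hl⟩ := hK.exists_cell _ hp
  obtain ⟨j, hj⟩ := l.2.2 ⟨0, hr⟩
  obtain ⟨f, -, hf⟩ := l.exists_monotone_mem hj
  have := (hK.vertex_mem_iff f l).2 (graph_le_iff.2 hf)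
  rw [hl] at this
  exact ⟨f, this⟩

theorem singleton_mem (hK : IsChainComplex K cell v) (f : Fin r →o Fin s) : {v f} ∈ K :=
  hK.cell_graph f ▸ hK.cell_mem _

theorem segment_mem_iff (hK : IsChainComplex K cell v) (hr : 1 ≤ r) (f g : Fin r →o Fin s) :
    segment ℝ (v f) (v g) ∈ K ↔ ∃ i₀, ∀ i, i ≠ i₀ → f i = g i := by
  constructor
  · intro h
    obtain ⟨l, hl⟩ := hK.exists_cell _ h
    have hf := graph_le_iff.1
      ((hK.vertex_mem_iff f l).1 (by rw [hl]; exact left_mem_segment _ _ _))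
    have hg := graph_le_iff.1
      ((hK.vertex_mem_iff g l).1 (by rw [hl]; exact right_mem_segment _ _ _))
    by_contra hcon
    push Not at hcon
    obtain ⟨a, -, ha⟩ := hcon ⟨0, hr⟩
    obtain ⟨b, hba, hb⟩ := hcon a
    -- If `f` and `g` differ in two rows, switching only row `a` gives a third vertex of the same
    -- cell. It is extreme, yet would lie inside the segment.
    obtain ⟨u, hu⟩ : ∃ u : Fin r →o Fin s, ⇑u = Function.update f a (g a) := by
      refine ⟨⟨Function.update f a (g a), fun x y hxy => ?_⟩, rfl⟩
      have hmem : ∀ k, (k, Function.update f a (g a) k) ∈ l.1 := by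
        intro k
        by_cases hk : k = a
        · subst hk; simpa using hg k
        · simpa [hk] using hf k
      rcases hxy.eq_or_lt with rfl | hxy
      · rfl
      · exact l.snd_le (hmem x) (hmem y) hxy
    have hul : graph u ≤ l := by
      rw [graph_le_iff, hu]
      intro k
      by_cases hk : k = a
      · subst hk; simpa using hg k
      · simpa [hk] using hf k
    have hext := hK.extreme u l hul
    have hseg : v u ∈ segment ℝ (v f) (v g) := by
      rw [← hl]; exact (hK.vertex_mem_iff u l).2 hul
    rw [← insert_endpoints_openSegment] at hseg
    have huf : u ≠ f := by
      rintro rfl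
      have := congrFun hu a
      rw [Function.update_self] at this
      exact ha this
    have hug : u ≠ g := by
      rintro rfl
      have := congrFun hu b
      rw [Function.update_of_ne hba] at this
      exact hb this.symm
    rcases hseg with h1 | h1 | h1
    · exact huf (hK.vertex_injective h1)
    · exact hug (hK.vertex_injective h1)
    · exact huf (hK.vertex_injective (hext.2
        (by rw [hl]; exact left_mem_segment _ _ _) (by rw [hl]; exact right_mem_segment _ _ _)
        h1).symm)
  · rintro ⟨i₀, h⟩
    have : cell (ofPair f g h) = segment ℝ (v f) (v g) := by
      refine (hK.edge f g i₀ h).antisymm ((hK.convex _).segment_subset ?_ ?_)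
      · exact (hK.vertex_mem_iff _ _).2 (graph_le_iff.2 fun i => mem_ofPair.2 (Or.inl rfl))
      · exact (hK.vertex_mem_iff _ _).2 (graph_le_iff.2 fun i => mem_ofPair.2 (Or.inr rfl))
    exact this ▸ hK.cell_mem _

/-- The 1-skeleton is the composition graph. -/
theorem exists_skeleton_iso (hK : IsChainComplex K cell v) (hr : 1 ≤ r) :
    ∃ e : oneSkeleton K ≃g compositionGraph r s, ∀ p f, p.1 = v f → e p = fiberComposition f := by
  let e₁ : (Fin r →o Fin s) ≃ {p : E // {p} ∈ K} :=
    Equiv.ofBijective (fun f => ⟨v f, hK.singleton_mem f⟩)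
      ⟨fun f g h => hK.vertex_injective (congrArg Subtype.val h), fun p => by
        obtain ⟨f, hf⟩ := hK.exists_vertex_eq hr p.2
        exact ⟨f, Subtype.ext hf⟩⟩
  let e₂ : (Fin r →o Fin s) ≃ WeakComposition r s :=
    Equiv.ofBijective fiberComposition ⟨fiberComposition_injective, fiberComposition_surjective⟩
  have he₁ : ∀ f, (e₁ f).1 = v f := fun _ => rfl
  have he : ∀ f, (e₁.symm.trans e₂) (e₁ f) = fiberComposition f := fun f => by
    rw [Equiv.trans_apply, Equiv.symm_apply_apply]; rfl
  refine ⟨⟨e₁.symm.trans e₂, ?_⟩, ?_⟩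
  · intro p q
    obtain ⟨f, rfl⟩ := e₁.surjective p
    obtain ⟨g, rfl⟩ := e₁.surjective q
    rw [he, he, adj_fiberComposition_iff, ← hK.segment_mem_iff hr f g]
    exact and_congr_left fun _ => (e₁.injective.ne_iff (x := f) (y := g)).symm
  · intro p f hp
    obtain rfl : p = e₁ f := Subtype.ext hp
    exact he f

end IsChainComplex

/-! ### Lattice paths and chains -/

theorem IsLatticePath.isChain {r s : ℕ} {l : Finset (Fin r × Fin s)} (h : IsLatticePath l) :
    IsChain (· ≤ ·) (l : Set (Fin r × Fin s)) := by
  obtain ⟨m, p, -, -, hstep, rfl⟩ := h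
  have hmono : ∀ b, b ≤ m → ∀ a, a ≤ b → p a ≤ p b := by
    intro b
    induction b with
    | zero => intro _ a ha; rw [Nat.le_zero.1 ha]
    | succ b ih =>
      intro hb a ha
      rcases ha.eq_or_lt with rfl | ha
      · exact le_rfl
      · refine (ih (by omega) a (by omega)).trans ?_
        rcases hstep b (by omega) with h | h
        · exact ⟨Fin.le_def.2 (by omega), h.2.ge⟩
        · exact ⟨h.1.ge, Fin.le_def.2 (by omega)⟩
  intro x hx y hy _
  obtain ⟨a, ha, rfl⟩ := Finset.mem_image.1 (Finset.mem_coe.1 hx)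
  obtain ⟨b, hb, rfl⟩ := Finset.mem_image.1 (Finset.mem_coe.1 hy)
  rw [Finset.mem_range] at ha hb
  rcases le_total a b with h | h
  · exact Or.inl (hmono b (by omega) a h)
  · exact Or.inr (hmono a (by omega) b h)

/-- Build the path backwards from `v`: remove `v` from the chain and continue from a neighbour `u`
that still dominates all other points. -/
theorem exists_path_of_isChain {r s : ℕ} (N : ℕ) (v : Fin r × Fin s) (hv : v.1.val + v.2.val = N)
    (l : Finset (Fin r × Fin s)) (hl : IsChain (· ≤ ·) (l : Set (Fin r × Fin s)))
    (hle : ∀ x ∈ l, x ≤ v) :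
    ∃ (m : ℕ) (p : ℕ → Fin r × Fin s), ((p 0).1.val = 0 ∧ (p 0).2.val = 0) ∧ p m = v ∧
      (∀ k < m,
        ((p (k + 1)).1.val = (p k).1.val + 1 ∧ (p (k + 1)).2 = (p k).2) ∨
        ((p (k + 1)).1 = (p k).1 ∧ (p (k + 1)).2.val = (p k).2.val + 1)) ∧
      l ⊆ (Finset.range (m + 1)).image p := by
  induction N generalizing v l with
  | zero =>
    refine ⟨0, fun _ => v, ⟨by simp only; omega, by simp only; omega⟩, rfl, by simp, fun x hx => ?_⟩
    have h1 := hle x hx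
    have h2 := Fin.le_def.1 h1.1
    have h3 := Fin.le_def.1 h1.2
    have : x = v := Prod.ext (Fin.ext (by omega)) (Fin.ext (by omega))
    simp [this]
  | succ N ih =>
    have extend : ∀ u : Fin r × Fin s, u.1.val + u.2.val = N →
        ((v.1.val = u.1.val + 1 ∧ v.2 = u.2) ∨ (v.1 = u.1 ∧ v.2.val = u.2.val + 1)) →
        (∀ x ∈ l, x ≠ v → x ≤ u) → ∃ (m : ℕ) (p : ℕ → Fin r × Fin s),
        ((p 0).1.val = 0 ∧ (p 0).2.val = 0) ∧ p m = v ∧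
        (∀ k < m,
          ((p (k + 1)).1.val = (p k).1.val + 1 ∧ (p (k + 1)).2 = (p k).2) ∨
          ((p (k + 1)).1 = (p k).1 ∧ (p (k + 1)).2.val = (p k).2.val + 1)) ∧
        l ⊆ (Finset.range (m + 1)).image p := by
      intro u hu hstep hlu
      obtain ⟨m, p, h0, hm, hs, hsub⟩ := ih u hu (l.erase v)
        (hl.mono (by simp))
        (fun x hx => hlu x (Finset.mem_of_mem_erase hx) (Finset.ne_of_mem_erase hx))
      refine ⟨m + 1, fun k => if k ≤ m then p k else v, by simpa using h0, by simp, ?_, ?_⟩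
      · intro k hk
        rcases Nat.lt_or_ge k m with h | h
        · simpa [h.le, Nat.succ_le_of_lt h] using hs k h
        · obtain rfl : k = m := by omega
          simpa [hm] using hstep
      · intro x hx
        rw [Finset.mem_image]
        by_cases hxv : x = v
        · exact ⟨m + 1, by simp, by simp [hxv]⟩
        · obtain ⟨k, hk, rfl⟩ := Finset.mem_image.1 (hsub (Finset.mem_erase.2 ⟨hxv, hx⟩))
          rw [Finset.mem_range] at hk
          exact ⟨k, by simp; omega, by simp [Nat.le_of_lt_succ hk]⟩
    by_cases hrow : v.1.val ≠ 0 ∧ ∀ x ∈ l, x ≠ v → x.1 < v.1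
    · refine extend (⟨v.1.val - 1, by omega⟩, v.2) (by simp; omega)
        (Or.inl ⟨by simp; omega, rfl⟩) fun x hx hxv => ⟨?_, (hle x hx).2⟩
      have := Fin.lt_def.1 (hrow.2 x hx hxv)
      rw [Fin.le_def]; simp; omega
    -- If `v` lies in the first row, distinct points below it lie in smaller columns. Otherwise some
    -- other point lies in the row of `v`, and it would be incomparable to another point in the
    -- column of `v`.
    · have hcol : v.2.val ≠ 0 ∧ ∀ x ∈ l, x ≠ v → x.2 < v.2 := by
        rw [not_and_or] at hrow
        rcases hrow with h0 | hex
        · rw [not_not] at h0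
          refine ⟨by omega, fun x hx hxv => lt_of_le_of_ne (hle x hx).2 fun h => hxv ?_⟩
          have := Fin.le_def.1 (hle x hx).1
          exact Prod.ext (Fin.ext (by omega)) h
        · push Not at hex
          obtain ⟨x, hx, hxv, hx1⟩ := hex
          have hx1 : x.1 = v.1 := le_antisymm (hle x hx).1 hx1
          have hx2 : x.2 < v.2 :=
            lt_of_le_of_ne (hle x hx).2 fun h => hxv (Prod.ext hx1 h)
          have hx2' := Fin.lt_def.1 hx2
          refine ⟨by omega, fun y hy hyv => lt_of_le_of_ne (hle y hy).2 fun h => hyv ?_⟩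
          refine Prod.ext ?_ h
          have hxy : x ≠ y := by rintro rfl; exact absurd h hx2.ne
          rcases hl hx hy hxy with h' | h'
          · exact le_antisymm (hle y hy).1 (hx1 ▸ h'.1)
          · exact absurd h'.2 (not_le.2 (h ▸ hx2))
      refine extend (v.1, ⟨v.2.val - 1, by omega⟩) (by simp; omega)
        (Or.inr ⟨rfl, by simp; omega⟩) fun x hx hxv => ⟨(hle x hx).1, ?_⟩
      have := Fin.lt_def.1 (hcol.2 x hx hxv)
      rw [Fin.le_def]; simp; omega

theorem isPartialLatticePath_iff {r s : ℕ} (hr : 1 ≤ r) (hs : 1 ≤ s) {l : Finset (Fin r × Fin s)} :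
    IsPartialLatticePath l ↔ IsChain (· ≤ ·) (l : Set (Fin r × Fin s)) := by
  constructor
  · rintro ⟨l', hl', hsub⟩
    exact hl'.isChain.mono (by exact_mod_cast hsub)
  · intro hl
    obtain ⟨m, p, h0, hm, hstep, hsub⟩ := exists_path_of_isChain _
      (⟨r - 1, by omega⟩, ⟨s - 1, by omega⟩) rfl l hl
      fun x _ => ⟨Fin.le_def.2 (by simp; omega), Fin.le_def.2 (by simp; omega)⟩
    exact ⟨_, ⟨m, p, h0, by rw [hm]; simp; omega, hstep, rfl⟩, hsub⟩

/-! ### Couplings supported on chains -/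

/-- A chain with a point in the first `a` rows but outside the first `b` columns has all its points
of the first `b` columns in the first `a` rows. Otherwise its first `a` rows lie in the first `b`
columns. -/
theorem sum_lt_and_lt_eq_min {r s : ℕ} {l : Finset (Fin r × Fin s)}
    (hl : IsChain (· ≤ ·) (l : Set (Fin r × Fin s))) {w : Fin r × Fin s → ℝ} (h0 : ∀ x, 0 ≤ w x)
    (hw : ∀ x, x ∉ l → w x = 0) (a b : ℕ) :
    ∑ x, (if x.1.val < a ∧ x.2.val < b then w x else 0) =
      min (∑ i, if i.val < a then ∑ j, w (i, j) else 0)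
        (∑ j, if j.val < b then ∑ i, w (i, j) else 0) := by
  have hR : (∑ i : Fin r, if i.val < a then ∑ j, w (i, j) else 0)
      = ∑ x : Fin r × Fin s, if x.1.val < a then w x else 0 := by
    rw [Fintype.sum_prod_type]
    exact Finset.sum_congr rfl fun i _ => by split_ifs <;> simp
  have hC : (∑ j : Fin s, if j.val < b then ∑ i, w (i, j) else 0)
      = ∑ x : Fin r × Fin s, if x.2.val < b then w x else 0 := by
    rw [Fintype.sum_prod_type_right]
    exact Finset.sum_congr rfl fun i _ => by split_ifs <;> simp
  rw [hR, hC]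
  have hle1 : ∑ x, (if x.1.val < a ∧ x.2.val < b then w x else 0)
      ≤ ∑ x : Fin r × Fin s, if x.1.val < a then w x else 0 :=
    Finset.sum_le_sum fun x _ => by
      have := h0 x
      split_ifs <;> first | exact le_rfl | assumption | (exfalso; omega)
  have hle2 : ∑ x, (if x.1.val < a ∧ x.2.val < b then w x else 0)
      ≤ ∑ x : Fin r × Fin s, if x.2.val < b then w x else 0 :=
    Finset.sum_le_sum fun x _ => by
      have := h0 x
      split_ifs <;> first | exact le_rfl | assumption | (exfalso; omega)
  by_cases hex : ∃ y ∈ l, y.1.val < a ∧ ¬ y.2.val < b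
  · obtain ⟨y, hy, hya, hyb⟩ := hex
    rw [min_eq_right]
    · refine Finset.sum_congr rfl fun x _ => ?_
      by_cases hx : x ∈ l
      · by_cases hxb : x.2.val < b
        · have hxa : x.1.val < a := by
            by_contra hxa
            have hne : x ≠ y := by rintro rfl; exact hxa hya
            rcases hl hx hy hne with h | h
            · have := Fin.le_def.1 h.1; omega
            · have := Fin.le_def.1 h.2; omega
          simp [hxa, hxb]
        · simp [hxb]
      · simp [hw x hx]
    · refine le_trans (le_of_eq ?_) hle1
      refine Finset.sum_congr rfl fun x _ => ?_
      by_cases hx : x ∈ l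
      · by_cases hxb : x.2.val < b
        · have hxa : x.1.val < a := by
            by_contra hxa
            have hne : x ≠ y := by rintro rfl; exact hxa hya
            rcases hl hx hy hne with h | h
            · have := Fin.le_def.1 h.1; omega
            · have := Fin.le_def.1 h.2; omega
          simp [hxa, hxb]
        · simp [hxb]
      · simp [hw x hx]
  · push Not at hex
    have heq : ∑ x, (if x.1.val < a ∧ x.2.val < b then w x else 0)
        = ∑ x : Fin r × Fin s, if x.1.val < a then w x else 0 := by
      refine Finset.sum_congr rfl fun x _ => ?_
      by_cases hx : x ∈ l
      · by_cases hxa : x.1.val < a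
        · simp [hxa, hex x hx hxa]
        · simp [hxa]
      · simp [hw x hx]
    rw [min_eq_left (heq ▸ hle2), heq]

theorem coupling_unique {r s : ℕ} {l l' : Finset (Fin r × Fin s)}
    (hl : IsChain (· ≤ ·) (l : Set (Fin r × Fin s)))
    (hl' : IsChain (· ≤ ·) (l' : Set (Fin r × Fin s))) {w w' : Fin r × Fin s → ℝ}
    (h0 : ∀ x, 0 ≤ w x) (h0' : ∀ x, 0 ≤ w' x) (hw : ∀ x, x ∉ l → w x = 0)
    (hw' : ∀ x, x ∉ l' → w' x = 0) (hrow : ∀ i, ∑ j, w (i, j) = ∑ j, w' (i, j))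
    (hcol : ∀ j, ∑ i, w (i, j) = ∑ i, w' (i, j)) : w = w' := by
  have hcdf : ∀ a b : ℕ, ∑ x : Fin r × Fin s, (if x.1.val < a ∧ x.2.val < b then w x else 0) =
      ∑ x : Fin r × Fin s, (if x.1.val < a ∧ x.2.val < b then w' x else 0) := by
    intro a b
    rw [sum_lt_and_lt_eq_min hl h0 hw, sum_lt_and_lt_eq_min hl' h0' hw']
    simp only [hrow, hcol]
  -- Inclusion–exclusion recovers a single weight from the masses of four corner rectangles, which
  -- the marginals determine.
  have hpt : ∀ (u : Fin r × Fin s → ℝ) (y : Fin r × Fin s), u y =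
      (∑ x : Fin r × Fin s, (if x.1.val < y.1.val + 1 ∧ x.2.val < y.2.val + 1 then u x else 0))
      - (∑ x : Fin r × Fin s, (if x.1.val < y.1.val ∧ x.2.val < y.2.val + 1 then u x else 0))
      - (∑ x : Fin r × Fin s, (if x.1.val < y.1.val + 1 ∧ x.2.val < y.2.val then u x else 0))
      + (∑ x : Fin r × Fin s, (if x.1.val < y.1.val ∧ x.2.val < y.2.val then u x else 0)) := by
    intro u y
    rw [← Finset.sum_sub_distrib, ← Finset.sum_sub_distrib, ← Finset.sum_add_distrib,
      Finset.sum_eq_single y]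
    · simp
    · intro x _ hxy
      have : x.1.val ≠ y.1.val ∨ x.2.val ≠ y.2.val := by
        by_contra h
        push Not at h
        exact hxy (Prod.ext (Fin.ext h.1) (Fin.ext h.2))
      split_ifs <;> first | (exfalso; omega) | ring
    · simp
  ext y
  rw [hpt w y, hpt w' y, hcdf, hcdf, hcdf, hcdf]

/-! ### Cells of the mixed subdivision -/

theorem mem_convexHull_productVertex_iff {r s : ℕ} {l : Finset (Fin r × Fin s)}
    {x : (Fin r → ℝ) × (Fin s → ℝ)} :
    x ∈ convexHull ℝ (productVertex '' (l : Set (Fin r × Fin s))) ↔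
      ∃ w : Fin r × Fin s → ℝ, (∀ v, 0 ≤ w v) ∧ (∀ v, v ∉ l → w v = 0) ∧ ∑ v, w v = 1 ∧
        (∀ i, x.1 i = ∑ j, w (i, j)) ∧ ∀ j, x.2 j = ∑ i, w (i, j) := by
  constructor
  · intro hx
    refine convexHull_min (t := {x : (Fin r → ℝ) × (Fin s → ℝ) | ∃ w : Fin r × Fin s → ℝ,
      (∀ v, 0 ≤ w v) ∧ (∀ v, v ∉ l → w v = 0) ∧ ∑ v, w v = 1 ∧
        (∀ i, x.1 i = ∑ j, w (i, j)) ∧ ∀ j, x.2 j = ∑ i, w (i, j)}) ?_ ?_ hx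
    · rintro _ ⟨⟨a, b⟩, hv, rfl⟩
      refine ⟨fun v => if v = (a, b) then 1 else 0, fun v => by dsimp only; split_ifs <;> norm_num,
        fun v hvl => if_neg ?_, by simp, fun i => ?_, fun j => ?_⟩
      · rintro rfl; exact hvl hv
      · by_cases h : i = a <;> simp [productVertex, Prod.ext_iff, h]
      · by_cases h : j = b <;> simp [productVertex, Prod.ext_iff, h]
    · rintro x ⟨w, h0, hl, h1, hr, hc⟩ y ⟨w', h0', hl', h1', hr', hc'⟩ a b ha hb hab
      refine ⟨fun v => a * w v + b * w' v, fun v => ?_, fun v hv => ?_, ?_, fun i => ?_,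
        fun j => ?_⟩
      · have := h0 v; have := h0' v; positivity
      · simp [hl v hv, hl' v hv]
      · rw [Finset.sum_add_distrib, ← Finset.mul_sum, ← Finset.mul_sum, h1, h1', mul_one, mul_one,
          hab]
      · simp [Finset.sum_add_distrib, ← Finset.mul_sum, hr, hr']
      · simp [Finset.sum_add_distrib, ← Finset.mul_sum, hc, hc']
  · rintro ⟨w, h0, hl, h1, hr, hc⟩
    have hx : x = ∑ v ∈ l, w v • productVertex v := by
      have hsum : ∑ v ∈ l, w v • productVertex v = ∑ v, w v • productVertex v :=
        Finset.sum_subset (Finset.subset_univ _) fun v _ hv => by rw [hl v hv, zero_smul]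
      rw [hsum]
      refine Prod.ext (funext fun i => ?_) (funext fun j => ?_)
      · rw [Prod.fst_sum, Finset.sum_apply, hr, Fintype.sum_prod_type, Finset.sum_eq_single i]
        · simp [productVertex]
        · intro k _ hk
          simp [productVertex, hk.symm]
        · simp
      · rw [Prod.snd_sum, Finset.sum_apply, hc, Fintype.sum_prod_type_right,
          Finset.sum_eq_single j]
        · simp [productVertex]
        · intro k _ hk
          simp [productVertex, hk.symm]
        · simp
    rw [hx]
    refine (convex_convexHull ℝ _).sum_mem (fun v _ => h0 v) ?_ fun v hv =>
      subset_convexHull ℝ _ ⟨v, hv, rfl⟩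
    rw [← h1]
    exact Finset.sum_subset (Finset.subset_univ _) fun v _ hv => hl v hv

/-- The cell of the mixed subdivision given by a set of grid points. -/
def mixedCell {r s : ℕ} (l : Finset (Fin r × Fin s)) : Set ((Fin r → ℝ) × (Fin s → ℝ)) :=
  convexHull ℝ (productVertex '' (l : Set (Fin r × Fin s))) ∩ slicePlane r s

/-- Barycentric coordinates, supported on `l`, of a point of the slice with second factor `x`. -/
structure IsSliceCoupling {r s : ℕ} (l : Finset (Fin r × Fin s)) (x : Fin s → ℝ)
    (w : Fin r × Fin s → ℝ) : Prop where
  nonneg : ∀ v, 0 ≤ w v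
  support : ∀ v, v ∉ l → w v = 0
  row : ∀ i, ∑ j, w (i, j) = 1 / (r : ℝ)
  col : ∀ j, ∑ i, w (i, j) = x j

theorem mem_mixedCell_iff {r s : ℕ} (hr : 1 ≤ r) {l : Finset (Fin r × Fin s)}
    {x : (Fin r → ℝ) × (Fin s → ℝ)} :
    x ∈ mixedCell l ↔ x.1 = (fun _ => 1 / (r : ℝ)) ∧ ∃ w, IsSliceCoupling l x.2 w := by
  have hr0 : (r : ℝ) ≠ 0 := by positivity
  rw [mixedCell, Set.mem_inter_iff, mem_convexHull_productVertex_iff]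
  constructor
  · rintro ⟨⟨w, h0, hl, h1, hrow, hcol⟩, hx⟩
    exact ⟨funext hx, w, h0, hl, fun i => by rw [← hrow, hx i], fun j => (hcol j).symm⟩
  · rintro ⟨hx, w, hw⟩
    refine ⟨⟨w, hw.nonneg, hw.support, ?_, fun i => ?_, fun j => (hw.col j).symm⟩, fun i => ?_⟩
    · rw [Fintype.sum_prod_type]
      simp [hw.row, hr0]
    · rw [hx, hw.row]
    · rw [hx]

theorem IsSliceCoupling.unique {r s : ℕ} {l l' : RowCoveringChain r s} {x : Fin s → ℝ}
    {w w' : Fin r × Fin s → ℝ} (h : IsSliceCoupling l.1 x w) (h' : IsSliceCoupling l'.1 x w') :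
    w = w' :=
  coupling_unique l.2.1 l'.2.1 h.nonneg h'.nonneg h.support h'.support
    (fun i => by rw [h.row, h'.row]) fun j => by rw [h.col, h'.col]

/-- The vertex of the mixed subdivision given by a monotone map. -/
noncomputable def mixedVertex {r s : ℕ} (f : Fin r →o Fin s) : (Fin r → ℝ) × (Fin s → ℝ) :=
  (fun _ => 1 / (r : ℝ), fun k => ((fiberComposition f).1 k : ℝ) / (r : ℝ))

theorem isSliceCoupling_graph {r s : ℕ} (f : Fin r →o Fin s) :
    IsSliceCoupling (graph f).1 (mixedVertex f).2
      (fun v => if v.2 = f v.1 then 1 / (r : ℝ) else 0) := by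
  refine ⟨fun v => by split_ifs <;> positivity, fun v hv => if_neg fun h => hv (mem_graph.2 h),
    fun i => by simp, fun j => ?_⟩
  rw [← Finset.sum_filter, Finset.sum_const, nsmul_eq_mul, mul_one_div]
  show _ = ((Finset.univ.filter fun i => f i = j).card : ℝ) / r
  congr 3
  ext i
  simp only [Finset.mem_filter, Finset.mem_univ, true_and]
  exact eq_comm

theorem IsSliceCoupling.mono {r s : ℕ} {l l' : Finset (Fin r × Fin s)} {x : Fin s → ℝ}
    {w : Fin r × Fin s → ℝ} (h : IsSliceCoupling l x w) (hl : l ⊆ l') : IsSliceCoupling l' x w :=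
  ⟨h.nonneg, fun v hv => h.support v fun hv' => hv (hl hv'), h.row, h.col⟩

theorem IsSliceCoupling.combo {r s : ℕ} {l : Finset (Fin r × Fin s)} {x x' : Fin s → ℝ}
    {w w' : Fin r × Fin s → ℝ} (h : IsSliceCoupling l x w) (h' : IsSliceCoupling l x' w')
    {a b : ℝ} (ha : 0 ≤ a) (hb : 0 ≤ b) (hab : a + b = 1) :
    IsSliceCoupling l (a • x + b • x') (fun v => a * w v + b * w' v) := by
  refine ⟨fun v => ?_, fun v hv => ?_, fun i => ?_, fun j => ?_⟩
  · have := h.nonneg v; have := h'.nonneg v; positivity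
  · simp [h.support v hv, h'.support v hv]
  · rw [Finset.sum_add_distrib, ← Finset.mul_sum, ← Finset.mul_sum, h.row, h'.row, ← add_mul, hab,
      one_mul]
  · rw [Finset.sum_add_distrib, ← Finset.mul_sum, ← Finset.mul_sum, h.col, h'.col]; simp

theorem mixedVertex_mem_iff {r s : ℕ} (hr : 1 ≤ r) (f : Fin r →o Fin s)
    (l : RowCoveringChain r s) : mixedVertex f ∈ mixedCell l.1 ↔ graph f ≤ l := by
  rw [mem_mixedCell_iff hr]
  constructor
  · rintro ⟨-, w, hw⟩
    rw [graph_le_iff]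
    intro i
    by_contra hi
    have h1 := hw.support _ hi
    rw [hw.unique (isSliceCoupling_graph f)] at h1
    have : (r : ℝ) ≠ 0 := by positivity
    simp [this] at h1
  · exact fun h => ⟨rfl, _, (isSliceCoupling_graph f).mono h⟩

theorem mixedCell_graph {r s : ℕ} (hr : 1 ≤ r) (f : Fin r →o Fin s) :
    mixedCell (graph f).1 = {mixedVertex f} := by
  ext x
  constructor
  · intro hx
    obtain ⟨h1, w, hw⟩ := (mem_mixedCell_iff hr).1 hx
    have hweq : w = fun v => if v.2 = f v.1 then 1 / (r : ℝ) else 0 := by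
      ext ⟨i, j⟩
      by_cases hj : j = f i
      · subst hj
        rw [if_pos rfl, ← hw.row i, Finset.sum_eq_single (f i)]
        · intro k _ hk
          exact hw.support _ fun h => hk (mem_graph.1 h)
        · simp
      · rw [if_neg hj]
        exact hw.support _ fun h => hj (mem_graph.1 h)
    refine Prod.ext h1 (funext fun j => ?_)
    rw [← hw.col j, hweq, (isSliceCoupling_graph f).col j]
  · rintro rfl
    exact (mixedVertex_mem_iff hr f _).2 le_rfl

/-- If the coupling on a graph is a proper convex combination of two couplings, nonnegativity forces
both onto the graph, where the row sums determine them. -/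
theorem mixedVertex_mem_extremePoints {r s : ℕ} (hr : 1 ≤ r) (f : Fin r →o Fin s)
    (l : RowCoveringChain r s) (h : graph f ≤ l) :
    mixedVertex f ∈ (mixedCell l.1).extremePoints ℝ := by
  refine ⟨(mixedVertex_mem_iff hr f l).2 h, ?_⟩
  rintro x hx y hy ⟨a, b, ha, hb, hab, heq⟩
  obtain ⟨hx1, w, hw⟩ := (mem_mixedCell_iff hr).1 hx
  obtain ⟨hy1, w', hw'⟩ := (mem_mixedCell_iff hr).1 hy
  have h1 := hw.combo hw' ha.le hb.le hab
  have h2 : a • x.2 + b • y.2 = (mixedVertex f).2 := congrArg Prod.snd heq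
  rw [h2] at h1
  have h3 := h1.unique (isSliceCoupling_graph f)
  have h4 : x ∈ mixedCell (graph f).1 := by
    refine (mem_mixedCell_iff hr).2 ⟨hx1, w, hw.nonneg, fun v hv => ?_, hw.row, hw.col⟩
    have h5 := congrFun h3 v
    simp only [if_neg fun h => hv (mem_graph.2 h)] at h5
    have h6 := mul_nonneg ha.le (hw.nonneg v)
    have h7 := mul_nonneg hb.le (hw'.nonneg v)
    exact (mul_eq_zero.1 (by linarith : a * w v = 0)).resolve_left ha.ne'
  rwa [mixedCell_graph hr] at h4

theorem mixedCell_ofPair_subset {r s : ℕ} (hr : 1 ≤ r) (f g : Fin r →o Fin s) (i₀ : Fin r)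
    (h : ∀ i, i ≠ i₀ → f i = g i) :
    mixedCell (ofPair f g h).1 ⊆ segment ℝ (mixedVertex f) (mixedVertex g) := by
  intro x hx
  obtain ⟨hx1, w, hw⟩ := (mem_mixedCell_iff hr).1 hx
  have hr0 : (r : ℝ) ≠ 0 := by positivity
  have hrow : ∀ i, f i = g i → w (i, f i) = 1 / r := by
    intro i hi
    rw [← hw.row i, Finset.sum_eq_single (f i)]
    · intro k _ hk
      exact hw.support _ fun h' => by
        have h' := mem_ofPair.1 h'
        rw [← hi, or_self] at h'
        exact hk h'
    · simp
  have hrow' : ∀ i, f i ≠ g i → w (i, f i) + w (i, g i) = 1 / r := by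
    intro i hi
    rw [← hw.row i, Finset.sum_eq_add (f i) (g i) hi]
    · rintro k - ⟨hk, hk'⟩
      refine hw.support _ fun h' => ?_
      rcases mem_ofPair.1 h' with h' | h'
      · exact hk h'
      · exact hk' h'
    · simp
    · simp
  -- Only the split of the mass `1/r` in row `i₀` is free; `a` is the fraction placed on `f`.
  set a : ℝ := r * w (i₀, f i₀) with ha
  have ha0 : 0 ≤ a := mul_nonneg (by positivity) (hw.nonneg _)
  have hwi : w (i₀, f i₀) = a * (1 / r) := by rw [ha]; field_simp
  have ha1 : a ≤ 1 := by
    have : w (i₀, f i₀) ≤ 1 / r := by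
      by_cases hi : f i₀ = g i₀
      · exact (hrow i₀ hi).le
      · have h1 := hrow' i₀ hi
        have h2 := hw.nonneg (i₀, g i₀)
        linarith
    rw [ha]
    calc (r : ℝ) * w (i₀, f i₀) ≤ r * (1 / r) := by gcongr
      _ = 1 := by field_simp
  have hweq : w = fun v => a * (if v.2 = f v.1 then 1 / (r : ℝ) else 0)
      + (1 - a) * (if v.2 = g v.1 then 1 / (r : ℝ) else 0) := by
    ext ⟨i, j⟩
    by_cases hi : f i = g i
    · by_cases hj : j = f i
      · subst hj
        rw [hrow i hi, if_pos rfl, if_pos hi]; ring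
      · have hj' : j ≠ g i := fun h' => hj (h'.trans hi.symm)
        simp only [if_neg hj, if_neg hj']
        rw [hw.support]
        · ring
        · rw [mem_ofPair, ← hi, or_self]; exact hj
    · obtain rfl : i = i₀ := by
        by_contra hne
        exact hi (h i hne)
      by_cases hj : j = f i
      · subst hj
        simp only [if_true, if_neg hi]
        rw [hwi]; ring
      · by_cases hj' : j = g i
        · subst hj'
          simp only [if_true, if_neg hj]
          linear_combination hrow' i hi - hwi
        · simp only [if_neg hj, if_neg hj']
          rw [hw.support]
          · ring
          · rw [mem_ofPair]
            exact not_or.2 ⟨hj, hj'⟩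
  refine ⟨a, 1 - a, ha0, by linarith, by ring, ?_⟩
  refine Prod.ext ?_ (funext fun j => ?_)
  · rw [hx1]; ext i; simp [mixedVertex]
  · rw [← hw.col j, hweq, Finset.sum_add_distrib, ← Finset.mul_sum, ← Finset.mul_sum,
      (isSliceCoupling_graph f).col j, (isSliceCoupling_graph g).col j]
    rfl

theorem isChainComplex_mixedSubdivision {r s : ℕ} (hr : 1 ≤ r) (hs : 1 ≤ s) :
    IsChainComplex (mixedSubdivision r s) (fun l => mixedCell l.1) mixedVertex where
  cell_mem l := by
    obtain ⟨j, hj⟩ := l.2.2 ⟨0, hr⟩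
    obtain ⟨f, -, hf⟩ := l.exists_monotone_mem hj
    exact ⟨⟨_, (mixedVertex_mem_iff hr f l).2 (graph_le_iff.2 hf)⟩, _,
      ⟨l.1, ⟨_, hj⟩, (isPartialLatticePath_iff hr hs).2 l.2.1, rfl⟩, rfl⟩
  exists_cell := by
    rintro _ ⟨⟨x, hx⟩, _, ⟨l, -, hl, rfl⟩, rfl⟩
    obtain ⟨-, w, hw⟩ := (mem_mixedCell_iff hr).1 hx
    refine ⟨⟨l, (isPartialLatticePath_iff hr hs).1 hl, fun i => ?_⟩, rfl⟩
    by_contra hi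
    push Not at hi
    have h1 := hw.row i
    rw [Finset.sum_eq_zero fun j _ => hw.support _ (hi j)] at h1
    have : (r : ℝ) ≠ 0 := by positivity
    exact one_div_ne_zero this h1.symm
  mono l l' h := Set.inter_subset_inter_left _ (convexHull_mono (Set.image_mono h))
  convex l := by
    refine (convex_convexHull ℝ _).inter ?_
    intro x hx y hy a b _ _ hab i
    show a * x.1 i + b * y.1 i = _
    rw [hx i, hy i, ← add_mul, hab, one_mul]
  vertex_mem_iff := mixedVertex_mem_iff hr
  cell_graph := mixedCell_graph hr
  extreme := mixedVertex_mem_extremePoints hr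
  edge := mixedCell_ofPair_subset hr

/-! ### The grid inside the index set of the cyclic polytope -/

/-- The indices `i + 2j` (counted from `0`) of the points `(i, j)` of `l`. -/
def indexSupport {r s : ℕ} (n : ℕ) (l : Finset (Fin r × Fin s)) : Set (Fin n) :=
  {i | ∃ x ∈ l, x.1.val + 2 * x.2.val = i.val}

theorem indexSupport_mono {r s n : ℕ} {l l' : Finset (Fin r × Fin s)} (h : l ⊆ l') :
    indexSupport n l ⊆ indexSupport n l' := by
  rintro i ⟨x, hx, hi⟩
  exact ⟨x, h hx, hi⟩

theorem fst_add_two_mul_snd_lt {r s d n : ℕ} (hd : d = 2 * s - 2) (hn : n = r + d)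
    (x : Fin r × Fin s) : x.1.val + 2 * x.2.val < n := by
  have := x.1.2
  have := x.2.2
  omega

/-- The index `i + 2j` does not determine `(i, j)`, so a whole graph is compared at once: the points
`x i` of `l` with the same indices have weakly increasing rows, of the parity of `i`. The rows
therefore increase strictly, and `r` strictly increasing rows are all the rows. -/
theorem graph_le_of_indexSupport_subset {r s d n : ℕ} (hd : d = 2 * s - 2) (hn : n = r + d)
    {f : Fin r →o Fin s} {l : RowCoveringChain r s}
    (h : indexSupport n (graph f).1 ⊆ indexSupport n l.1) : graph f ≤ l := by
  have hx : ∀ i : Fin r, ∃ x ∈ l.1, x.1.val + 2 * x.2.val = i.val + 2 * (f i).val := fun i =>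
    h (show (⟨i.val + 2 * (f i).val, fst_add_two_mul_snd_lt hd hn (i, f i)⟩ : Fin n) ∈
      indexSupport n (graph f).1 from ⟨(i, f i), mem_graph.2 rfl, rfl⟩)
  choose x hxl hx using hx
  have hmono : ∀ i j : Fin r, i < j → (x i).1.val ≤ (x j).1.val := by
    intro i j hij
    by_contra hlt
    have h1 : (x j).1 < (x i).1 := Fin.lt_def.2 (not_le.1 hlt)
    have h2 := Fin.le_def.1 (l.snd_le (hxl j) (hxl i) h1)
    have h3 := Fin.le_def.1 (f.monotone hij.le)
    have h4 := Fin.lt_def.1 hij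
    have h5 := hx i
    have h6 := hx j
    omega
  have hlow : ∀ k : ℕ, ∀ hk : k < r, k ≤ (x ⟨k, hk⟩).1.val := by
    intro k
    induction k with
    | zero => intro _; omega
    | succ k ih =>
      intro hk
      have h1 := ih (by omega)
      have h2 := hmono ⟨k, by omega⟩ ⟨k + 1, hk⟩ (Fin.lt_def.2 (Nat.lt_succ_self k))
      have h3 := hx ⟨k + 1, hk⟩
      simp only at h3
      omega
  have hupp : ∀ m k : ℕ, ∀ hk : k < r, k + m + 1 = r → (x ⟨k, hk⟩).1.val ≤ k := by
    intro m
    induction m with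
    | zero => intro k hk hkr; have := (x ⟨k, hk⟩).1.2; omega
    | succ m ih =>
      intro k hk hkr
      have h1 := ih (k + 1) (by omega) (by omega)
      have h2 := hmono ⟨k, hk⟩ ⟨k + 1, by omega⟩ (Fin.lt_def.2 (Nat.lt_succ_self k))
      have h3 := hx ⟨k, hk⟩
      simp only at h3
      omega
  rw [graph_le_iff]
  intro i
  have h1 := hlow i.val i.2
  have h2 := hupp (r - 1 - i.val) i.val i.2 (by have := i.2; omega)
  have h3 := hx i
  have : x i = (i, f i) := Prod.ext (Fin.ext (by simp only [Fin.eta] at h1 h2 ⊢; omega))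
    (Fin.ext (by simp only [Fin.eta] at h1 h2 ⊢; omega))
  exact this ▸ hxl i

/-- A chain separates `d/2` further indices from each other. -/
theorem exists_nodes_of_chain {r s d n : ℕ} (hr : 1 ≤ r) (hd : d = 2 * s - 2) (hn : n = r + d)
    (l : RowCoveringChain r s) :
    ∃ X : Fin (d + 1) → Fin n, StrictMono X ∧
      ∀ m : Fin (d + 1), ¬ Even m.val → X m ∉ indexSupport n l.1 := by
  -- The largest row used in the columns before `k`, and `0` if there is none.
  let rho : ℕ → ℕ := fun k => (l.1.filter fun x => x.2.val < k).sup fun x => x.1.val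
  have hrho_mono : Monotone rho := fun a b hab => Finset.sup_mono fun x hx => by
    simp only [Finset.mem_filter] at hx ⊢
    exact ⟨hx.1, by omega⟩
  have hrho_le : ∀ k, rho k ≤ r - 1 := fun k => Finset.sup_le fun x _ => by
    have := x.1.2; omega
  refine ⟨fun m => ⟨rho ((m.val + 1) / 2) + m.val, ?_⟩, fun a b hab => ?_, fun m hm => ?_⟩
  · have := hrho_le ((m.val + 1) / 2)
    have := m.2
    omega
  · have h1 := Fin.lt_def.1 hab
    have h2 := hrho_mono (show (a.val + 1) / 2 ≤ (b.val + 1) / 2 by omega)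
    rw [Fin.lt_def]
    simp only
    omega
  -- For `m = 2k + 1` the node is `rho (k + 1) + 2k + 1`: points in columns up to `k` have smaller
  -- index, and points in later columns have index at least one more.
  · rintro ⟨x, hx, hxm⟩
    simp only at hxm
    obtain ⟨k, hk⟩ := Nat.not_even_iff_odd.1 hm
    rw [show (m.val + 1) / 2 = k + 1 by omega] at hxm
    by_cases hlt : x.2.val < k + 1
    · have : x.1.val ≤ rho (k + 1) :=
        Finset.le_sup (f := fun x : Fin r × Fin s => x.1.val) (Finset.mem_filter.2 ⟨hx, hlt⟩)
      omega
    · have : rho (k + 1) ≤ x.1.val := Finset.sup_le fun y hy => by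
        rw [Finset.mem_filter] at hy
        exact Fin.le_def.1 (l.fst_le hy.1 hx (Fin.lt_def.2 (by omega)))
      omega

/-- The embedding of the graph of a monotone map into the index set. -/
def graphIndex {r s d n : ℕ} (hd : d = 2 * s - 2) (hn : n = r + d) (f : Fin r →o Fin s)
    (i : Fin r) : Fin n :=
  ⟨i.val + 2 * (f i).val, fst_add_two_mul_snd_lt hd hn (i, f i)⟩

theorem graphIndex_strictMono {r s d n : ℕ} (hd : d = 2 * s - 2) (hn : n = r + d)
    (f : Fin r →o Fin s) : StrictMono (graphIndex hd hn f) := by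
  intro i j hij
  have h1 := Fin.lt_def.1 hij
  have h2 := Fin.le_def.1 (f.monotone hij.le)
  rw [Fin.lt_def]
  simp only [graphIndex]
  omega

/-- The indices outside the graph of a monotone map. -/
def graphCompl {r s d n : ℕ} (hd : d = 2 * s - 2) (hn : n = r + d) (f : Fin r →o Fin s) :
    Finset (Fin n) :=
  (Finset.univ.image (graphIndex hd hn f))ᶜ

theorem mem_graphCompl {r s d n : ℕ} {hd : d = 2 * s - 2} {hn : n = r + d} {f : Fin r →o Fin s}
    {h : Fin n} : h ∈ graphCompl hd hn f ↔ h ∉ indexSupport n (graph f).1 := by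
  rw [graphCompl, Finset.mem_compl, not_iff_not, Finset.mem_image]
  constructor
  · rintro ⟨i, -, rfl⟩
    exact ⟨(i, f i), mem_graph.2 rfl, rfl⟩
  · rintro ⟨⟨i, j⟩, hij, hh⟩
    obtain rfl : j = f i := mem_graph.1 hij
    exact ⟨i, Finset.mem_univ _, Fin.ext hh⟩

theorem card_graphCompl {r s d n : ℕ} (hd : d = 2 * s - 2) (hn : n = r + d)
    (f : Fin r →o Fin s) : (graphCompl hd hn f).card = d := by
  rw [graphCompl, Finset.card_compl,
    Finset.card_image_of_injective _ (graphIndex_strictMono hd hn f).injective]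
  simp
  omega

/-- Of the `i + 2 f(i)` indices below this one, exactly `i` belong to the graph. -/
theorem card_graphCompl_filter_lt {r s d n : ℕ} (hd : d = 2 * s - 2) (hn : n = r + d)
    (f : Fin r →o Fin s) (i : Fin r) :
    ((graphCompl hd hn f).filter (· < graphIndex hd hn f i)).card = 2 * (f i).val := by
  have h1 : (graphCompl hd hn f).filter (· < graphIndex hd hn f i)
      = Finset.Iio (graphIndex hd hn f i) \ (Finset.Iio i).image (graphIndex hd hn f) := by
    ext h
    simp only [graphCompl, Finset.mem_filter, Finset.mem_compl, Finset.mem_image, Finset.mem_univ,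
      true_and, Finset.mem_sdiff, Finset.mem_Iio]
    constructor
    · rintro ⟨hh, hlt⟩
      exact ⟨hlt, fun ⟨k, _, hk⟩ => hh ⟨k, hk⟩⟩
    · rintro ⟨hlt, hh⟩
      refine ⟨?_, hlt⟩
      rintro ⟨k, rfl⟩
      exact hh ⟨k, (graphIndex_strictMono hd hn f).lt_iff_lt.1 hlt, rfl⟩
  rw [h1, Finset.card_sdiff_of_subset, Finset.card_image_of_injective _
    (graphIndex_strictMono hd hn f).injective, Fin.card_Iio, Fin.card_Iio]
  · simp [graphIndex]
  · intro h hh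
    obtain ⟨k, hk, rfl⟩ := Finset.mem_image.1 hh
    exact Finset.mem_Iio.2 (graphIndex_strictMono hd hn f (Finset.mem_Iio.1 hk))

theorem even_card_graphCompl_filter_gt {r s d n : ℕ} (hd : d = 2 * s - 2) (hn : n = r + d)
    (f : Fin r →o Fin s) (i : Fin r) :
    Even ((graphCompl hd hn f).filter (graphIndex hd hn f i < ·)).card := by
  have h1 := card_graphCompl_filter_lt hd hn f i
  have h2 := Finset.card_filter_add_card_filter_not (s := graphCompl hd hn f)
    (· < graphIndex hd hn f i)
  have h3 : (graphCompl hd hn f).filter (fun h => ¬ h < graphIndex hd hn f i)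
      = (graphCompl hd hn f).filter (graphIndex hd hn f i < ·) := by
    refine Finset.filter_congr fun h hh => ?_
    have : h ≠ graphIndex hd hn f i := by
      rintro rfl
      exact mem_graphCompl.1 hh ⟨(i, f i), mem_graph.2 rfl, rfl⟩
    rw [not_lt]
    exact ⟨fun h' => lt_of_le_of_ne h' this.symm, le_of_lt⟩
  rw [h3, h1, card_graphCompl] at h2
  exact ⟨s - 1 - (f i).val, by omega⟩

theorem holeSize_graphCompl {r s d n : ℕ} (hd : d = 2 * s - 2) (hn : n = r + d)
    (f : Fin r →o Fin s) (k : Fin s) :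
    holeSize (graphCompl hd hn f) k.val = (fiberComposition f).1 k := by
  rw [fiberComposition_apply, holeSize,
    ← Finset.card_image_of_injective _ (graphIndex_strictMono hd hn f).injective]
  congr 1
  ext h
  simp only [Finset.mem_filter, Finset.mem_univ, true_and, Finset.mem_image]
  constructor
  · rintro ⟨hh, hcard⟩
    rw [graphCompl, Finset.mem_compl, not_not, Finset.mem_image] at hh
    obtain ⟨i, -, rfl⟩ := hh
    rw [card_graphCompl_filter_lt] at hcard
    exact ⟨i, Fin.ext (by omega), rfl⟩
  · rintro ⟨i, rfl, rfl⟩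
    refine ⟨?_, card_graphCompl_filter_lt hd hn f i⟩
    rw [graphCompl, Finset.mem_compl, not_not]
    exact Finset.mem_image_of_mem _ (Finset.mem_univ i)

/-! ### Sparse subsets -/

/-- Greedy choice: take the least element `a`, which covers `a` and `a + 1`, and continue with the
elements from `a + 2` on. -/
theorem exists_gaps_or_cover (m : ℕ) (J : Finset ℕ) :
    (∃ e : ℕ → ℕ, (∀ k < m, e k ∈ J) ∧ ∀ k, k + 1 < m → e k + 2 ≤ e (k + 1)) ∨
    ∃ T ⊆ J, T.card < m ∧ ∀ j ∈ J, j ∈ T ∨ ∃ i ∈ T, j = i + 1 := by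
  induction m generalizing J with
  | zero => exact Or.inl ⟨id, by simp, by simp⟩
  | succ m ih =>
    rcases J.eq_empty_or_nonempty with rfl | hne
    · exact Or.inr ⟨∅, by simp, by simp, by simp⟩
    · have hmin : ∀ j ∈ J, J.min' hne ≤ j := fun j hj => Finset.min'_le J j hj
      set a := J.min' hne with ha
      have haJ : a ∈ J := Finset.min'_mem J hne
      rcases ih (J.filter (a + 2 ≤ ·)) with ⟨e, he, hgap⟩ | ⟨T, hT, hcard, hcov⟩
      · refine Or.inl ⟨fun k => if k = 0 then a else e (k - 1), fun k hk => ?_, fun k hk => ?_⟩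
        · by_cases hk0 : k = 0
          · simpa [hk0] using haJ
          · simpa [hk0] using (Finset.mem_filter.1 (he (k - 1) (by omega))).1
        · by_cases hk0 : k = 0
          · simpa [hk0] using (Finset.mem_filter.1 (he 0 (by omega))).2
          · have := hgap (k - 1) (by omega)
            rw [Nat.sub_add_cancel (by omega)] at this
            simpa [hk0] using this
      · refine Or.inr ⟨insert a T, Finset.insert_subset haJ (hT.trans (Finset.filter_subset _ _)),
          (Finset.card_insert_le _ _).trans_lt (by omega), fun j hj => ?_⟩
        by_cases hja : a + 2 ≤ j
        · rcases hcov j (Finset.mem_filter.2 ⟨hj, hja⟩) with h | ⟨i, hi, h⟩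
          · exact Or.inl (Finset.mem_insert_of_mem h)
          · exact Or.inr ⟨i, Finset.mem_insert_of_mem hi, h⟩
        · have := hmin j hj
          rcases (by omega : j = a ∨ j = a + 1) with h | h
          · exact Or.inl (h ▸ Finset.mem_insert_self _ _)
          · exact Or.inr ⟨a, Finset.mem_insert_self _ _, h⟩

/-- Separated indices `e k` become the corners of a staircase, the indices skipped when it passes
from column `k` to column `k + 1`. -/
theorem exists_stair_of_gaps {r m : ℕ} (hr : 1 ≤ r) {e : ℕ → ℕ} (h1 : ∀ k < m, 1 ≤ e k)
    (h2 : ∀ k < m, e k + 2 ≤ r + 2 * m) (hgap : ∀ k, k + 1 < m → e k + 2 ≤ e (k + 1)) :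
    ∃ rho : ℕ → ℕ, Monotone rho ∧ rho 0 = 0 ∧ (∀ k, rho k ≤ r - 1) ∧ (∀ k, m < k → rho k = r - 1) ∧
      ∀ k < m, rho (k + 1) + 2 * k + 1 = e k := by
  have hlow : ∀ k < m, 2 * k + 1 ≤ e k := by
    intro k
    induction k with
    | zero => exact h1 0
    | succ k ih => intro hk; have := ih (by omega); have := hgap k hk; omega
  have hupp' : ∀ j k, k + j + 1 = m → e k + 2 * j + 2 ≤ r + 2 * m := by
    intro j
    induction j with
    | zero => intro k hk; have := h2 k (by omega); omega
    | succ j ih =>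
      intro k hk
      have := ih (k + 1) (by omega)
      have := hgap k (by omega)
      omega
  have hupp : ∀ k < m, e k ≤ r + 2 * k := fun k hk => by
    have := hupp' (m - 1 - k) k (by omega); omega
  -- Solve `rho (k + 1) + 2k + 1 = e k`. The bounds `hlow` and `hupp` keep the subtraction exact and
  -- the value at most `r - 1`.
  refine ⟨fun k => if k = 0 then 0 else if m < k then r - 1 else e (k - 1) + 1 - 2 * k,
    monotone_nat_of_le_succ fun k => ?_, by simp, fun k => ?_, fun k hk => ?_, fun k hk => ?_⟩
  · rcases Nat.eq_zero_or_pos k with rfl | hk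
    · simp
    · rw [if_neg hk.ne', if_neg (Nat.succ_ne_zero k)]
      split_ifs with h h' h'
      · exact le_rfl
      · omega
      · have := hupp (k - 1) (by omega); omega
      · have := hgap (k - 1) (by omega)
        rw [Nat.sub_add_cancel hk] at this
        rw [Nat.add_sub_cancel]
        omega
  · dsimp only
    split_ifs with h h'
    · omega
    · exact le_rfl
    · have := hupp (k - 1) (by omega); omega
  · dsimp only
    rw [if_neg (by omega), if_pos hk]
  · dsimp only
    rw [if_neg (by omega), if_neg (by omega), Nat.add_sub_cancel]
    have := hlow k hk
    omega

end ChainComplexes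

/-! ### Supports of faces with positive leading coefficient are the row-covering chains -/

section LowerPolar

open RowCoveringChain Polynomial

/-! ### The lower part of the polar as a complex of chains -/

/-- The nodal polynomial of the complement is positive on the graph, because an even number of
complementary indices follows each graph index. -/
theorem exists_slackZeros_eq_graphCompl {r s d n : ℕ} (hd : d = 2 * s - 2) (hn : n = r + d)
    {t : Fin n → ℝ} (ht : StrictMono t) {c : Fin d → ℝ} (hc : c ∈ interior (cyclicPolytope d t))
    (f : Fin r →o Fin s) :
    ∃ y ∈ polarPolytope (cyclicPolytope d t) c, slackZeros t c y = graphCompl hd hn f := by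
  have hpos : ∀ h, h ∉ graphCompl hd hn f →
      0 < (Lagrange.nodal (graphCompl hd hn f) t).eval (t h) := by
    intro h hh
    have h1 := sign_prod_sub ht h _ hh
    rw [graphCompl, Finset.mem_compl, not_not, Finset.mem_image] at hh
    obtain ⟨i, -, rfl⟩ := hh
    rwa [(even_card_graphCompl_filter_gt hd hn f i).neg_one_pow, one_mul,
      ← Lagrange.eval_nodal] at h1
  obtain ⟨y, hy, a, ha, hya⟩ := exists_mem_polarPolytope hc
    (p := Lagrange.nodal (graphCompl hd hn f) t)
    (by rw [Lagrange.natDegree_nodal, card_graphCompl]) (fun h => by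
      by_cases hh : h ∈ graphCompl hd hn f
      · rw [Lagrange.eval_nodal_at_node hh]
      · exact (hpos h hh).le) Lagrange.nodal_ne_zero
  refine ⟨y, hy, ?_⟩
  ext h
  rw [mem_slackZeros, hya, eval_mul, eval_C, mul_eq_zero, or_iff_right ha.ne']
  constructor
  · intro h0
    by_contra hh
    exact (hpos h hh).ne' h0
  · exact fun hh => Lagrange.eval_nodal_at_node hh

theorem coeff_pos_of_mem_polarFace {r s d n : ℕ} (hr : 1 ≤ r) (hd : d = 2 * s - 2)
    (hn : n = r + d) {t : Fin n → ℝ} (ht : StrictMono t) {c y : Fin d → ℝ}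
    (l : RowCoveringChain r s) (hy : y ∈ polarFace t c (indexSupport n l.1)) :
    0 < (slackPoly c y).coeff d := by
  obtain ⟨X, hX, hodd⟩ := exists_nodes_of_chain hr hd hn l
  exact coeff_pos_of_even_nonneg ⟨s - 1, by omega⟩ (ht.comp hX) (natDegree_slackPoly_le c y)
    (slackPoly_ne_zero c y) (fun k _ => mem_polarPolytope_iff.1 hy.1 _)
    fun k hk => eval_slackPoly_eq_zero_of_mem_polarFace hy (hodd k hk)

/-- A sparse set of zeros admits a polynomial with nonpositive leading coefficient. -/
theorem exists_poly_of_cover {d n : ℕ} {t : Fin n → ℝ} (ht : StrictMono t) (hn : 2 ≤ n)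
    {T : Finset ℕ} (hT : ∀ j ∈ T, j + 1 < n) (hcard : 2 * T.card + 2 ≤ d) :
    ∃ p : ℝ[X], p ≠ 0 ∧ p.natDegree ≤ d ∧ p.coeff d ≤ 0 ∧ (∀ i, 0 ≤ p.eval (t i)) ∧
      ∀ i : Fin n, (i.val = 0 ∨ i.val = n - 1 ∨ i.val ∈ T ∨ ∃ j ∈ T, i.val = j + 1) →
        p.eval (t i) = 0 := by
  classical
  let u : ℕ → ℝ := fun j => if h : j < n then t ⟨j, h⟩ else 0
  have hu : ∀ i : Fin n, t i = u i.val := fun i => by simp [u]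
  have hule : ∀ i j : ℕ, i ≤ j → j < n → u i ≤ u j := fun i j hij hj => by
    simp only [u, dif_pos hj, dif_pos (hij.trans_lt hj)]
    exact ht.monotone (Fin.le_def.2 hij)
  set R : ℝ[X] := ∏ j ∈ T, ((X - C (u j)) * (X - C (u (j + 1)))) with hR
  have hRm : R.Monic := monic_prod_of_monic _ _ fun j _ => (monic_X_sub_C _).mul (monic_X_sub_C _)
  have hquad : ∀ a b : ℝ, ((X - C a) * (X - C b)).natDegree ≤ 2 := fun a b =>
    natDegree_mul_le.trans (by rw [natDegree_X_sub_C, natDegree_X_sub_C])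
  have hRd : R.natDegree ≤ T.card * 2 :=
    (natDegree_prod_le _ _).trans (Finset.sum_le_card_nsmul _ _ 2 fun j _ => hquad _ _)
  set P : ℝ[X] := ((X - C (u 0)) * (X - C (u (n - 1)))) * R with hP
  have hPm : P.Monic := ((monic_X_sub_C _).mul (monic_X_sub_C _)).mul hRm
  have hPd : P.natDegree ≤ d := by
    have h1 := natDegree_mul_le (p := (X - C (u 0)) * (X - C (u (n - 1)))) (q := R)
    have h2 := hquad (u 0) (u (n - 1))
    rw [← hP] at h1
    omega
  have heval : ∀ x, P.eval x = ((x - u 0) * (x - u (n - 1))) *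
      ∏ j ∈ T, ((x - u j) * (x - u (j + 1))) := by
    intro x
    simp [hP, hR, eval_prod]
  -- At every parameter the end factor is nonpositive, and each adjacent pair is nonnegative because
  -- no parameter lies strictly between its roots. So `-P` is nonnegative there, with coefficient
  -- `-1` or `0` in degree `d`.
  refine ⟨-P, neg_ne_zero.2 hPm.ne_zero, by rwa [natDegree_neg], ?_, fun i => ?_, fun i hi => ?_⟩
  · rw [coeff_neg, neg_nonpos]
    rcases hPd.eq_or_lt with h | h
    · have := hPm.coeff_natDegree
      rw [h] at this
      rw [this]; norm_num
    · rw [coeff_eq_zero_of_natDegree_lt h]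
  · rw [eval_neg, neg_nonneg, heval, hu]
    have h1 : 0 ≤ u i.val - u 0 := sub_nonneg.2 (hule 0 i.val (Nat.zero_le _) i.2)
    have h2 : u i.val - u (n - 1) ≤ 0 :=
      sub_nonpos.2 (hule i.val (n - 1) (by have := i.2; omega) (by omega))
    refine mul_nonpos_of_nonpos_of_nonneg (mul_nonpos_of_nonneg_of_nonpos h1 h2)
      (Finset.prod_nonneg fun j hj => ?_)
    have hjn := hT j hj
    rcases Nat.lt_or_ge j i.val with hij | hij
    · exact mul_nonneg (sub_nonneg.2 (hule _ _ hij.le i.2)) (sub_nonneg.2 (hule _ _ hij i.2))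
    · exact mul_nonneg_of_nonpos_of_nonpos (sub_nonpos.2 (hule _ _ hij (by omega)))
        (sub_nonpos.2 (hule _ _ (by omega) hjn))
  · rw [eval_neg, neg_eq_zero, heval, hu]
    rcases hi with h | h | h | ⟨j, hj, h⟩
    · rw [h]; simp
    · rw [h]; simp
    · rw [Finset.prod_eq_zero h (by simp), mul_zero]
    · rw [Finset.prod_eq_zero hj (by rw [h]; simp), mul_zero]

/-- The chain cut out from a staircase by the support `Z`. -/
theorem exists_chain_of_stair {r s n : ℕ} (hr : 1 ≤ r) (hn : n = r + 2 * (s - 1)) (hs : 1 ≤ s)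
    {rho : ℕ → ℕ} (hmono : Monotone rho) (h0 : rho 0 = 0) (hle : ∀ k, rho k ≤ r - 1)
    (hlast : ∀ k, s - 1 < k → rho k = r - 1) {Z : Set (Fin n)}
    (hZ : ∀ z ∈ Z, ∀ k < s - 1, z.val ≠ rho (k + 1) + 2 * k + 1)
    (hrow : ∀ q : ℕ → ℕ, (∀ k, q k + 2 ≤ q (k + 1)) → q (s - 1) < n →
      ∃ k < s, ∃ z ∈ Z, z.val = q k) :
    ∃ l : RowCoveringChain r s, indexSupport n l.1 = Z := by
  classical
  -- The staircase occupies rows `rho j` to `rho (j + 1)` in column `j`; its indices are all of `Fin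
  -- n` except the skipped ones, which `Z` avoids.
  set L : Finset (Fin r × Fin s) := Finset.univ.filter fun x =>
    (rho x.2.val ≤ x.1.val ∧ x.1.val ≤ rho (x.2.val + 1)) ∧
      ∃ z ∈ Z, x.1.val + 2 * x.2.val = z.val with hL
  have hmem : ∀ x, x ∈ L ↔ (rho x.2.val ≤ x.1.val ∧ x.1.val ≤ rho (x.2.val + 1)) ∧
      ∃ z ∈ Z, x.1.val + 2 * x.2.val = z.val := fun x => by simp [hL]
  refine ⟨⟨L, ?_, fun i => ?_⟩, ?_⟩
  · have key : ∀ x ∈ L, ∀ y ∈ L, x.2 < y.2 → x ≤ y := by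
      intro x hx y hy h
      have h1 := ((hmem x).1 hx).1.2
      have h2 := ((hmem y).1 hy).1.1
      have h3 := hmono (show x.2.val + 1 ≤ y.2.val from Fin.lt_def.1 h)
      exact ⟨Fin.le_def.2 (by omega), h.le⟩
    intro x hx y hy _
    rcases lt_trichotomy x.2 y.2 with h | h | h
    · exact Or.inl (key x hx y hy h)
    · rcases le_total x.1 y.1 with h' | h'
      · exact Or.inl ⟨h', h.le⟩
      · exact Or.inr ⟨h', h.ge⟩
    · exact Or.inr (key y hy x hx h)
  -- In column `k` take the index of `(i, k)` if it lies on the staircase, and otherwise the skipped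
  -- index just before or just after that column. Since `Z` avoids skipped indices, a hit comes from
  -- row `i`.
  · let q : ℕ → ℕ := fun k => if i.val < rho k then rho k + 2 * k - 1
      else if rho (k + 1) < i.val then rho (k + 1) + 2 * k + 1 else i.val + 2 * k
    have hgap : ∀ k, q k + 2 ≤ q (k + 1) := by
      intro k
      have h1 := hmono (Nat.le_succ k)
      have h2 := hmono (Nat.le_succ (k + 1))
      simp only [Nat.succ_eq_add_one] at h1 h2
      simp only [q]
      split_ifs <;> omega
    have hir := i.2
    have hqn : q (s - 1) < n := by
      have h1 := hle (s - 1)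
      have h2 := hlast (s - 1 + 1) (by omega)
      simp only [q]
      split_ifs <;> omega
    obtain ⟨k, hk, z, hz, hzq⟩ := hrow q hgap hqn
    simp only [q] at hzq
    split_ifs at hzq with h1 h2
    · have hk0 : k ≠ 0 := by rintro rfl; omega
      refine absurd ?_ (hZ z hz (k - 1) (by omega))
      rw [Nat.sub_add_cancel (by omega)]; omega
    · have hk' : k < s - 1 := by
        by_contra hk'
        have := hlast (k + 1) (by omega)
        omega
      exact absurd hzq (hZ z hz k hk')
    · exact ⟨⟨k, hk⟩, (hmem _).2 ⟨⟨not_lt.1 h1, not_lt.1 h2⟩, z, hz, hzq.symm⟩⟩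
  · ext z
    constructor
    · rintro ⟨x, hx, hxz⟩
      obtain ⟨-, z', hz', hxz'⟩ := (hmem x).1 hx
      rwa [show z = z' from Fin.ext (by omega)]
    · intro hz
      -- The column of `z` is the last one whose first index does not exceed `z`.
      set k := Nat.findGreatest (fun k => rho k + 2 * k ≤ z.val) (s - 1) with hk
      have hspec : rho k + 2 * k ≤ z.val :=
        Nat.findGreatest_spec (P := fun k => rho k + 2 * k ≤ z.val) (Nat.zero_le (s - 1))
          (by simp [h0])
      have hks : k ≤ s - 1 := Nat.findGreatest_le _
      have hzn := z.2
      have hupp : z.val ≤ rho (k + 1) + 2 * k := by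
        rcases hks.eq_or_lt with h | h
        · have := hlast (k + 1) (by omega)
          omega
        · have h1 : ¬ rho (k + 1) + 2 * (k + 1) ≤ z.val :=
            Nat.findGreatest_is_greatest (P := fun k => rho k + 2 * k ≤ z.val)
              (Nat.lt_succ_self k) h
          have h2 := hZ z hz k h
          omega
      have h3 := hle (k + 1)
      refine ⟨(⟨z.val - 2 * k, by omega⟩, ⟨k, by omega⟩), (hmem _).2 ⟨⟨?_, ?_⟩, z, hz, ?_⟩, ?_⟩ <;>
        simp only <;> omega

theorem coeff_nonpos_of_gaps {d n m : ℕ} (hd : d = 2 * m) {t : Fin n → ℝ} (ht : StrictMono t)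
    {c y : Fin d → ℝ} (hy : y ∈ polarPolytope (cyclicPolytope d t) c) {q : ℕ → ℕ}
    (hgap : ∀ k, q k + 2 ≤ q (k + 1)) (hqn : q m < n)
    (hq : ∀ k ≤ m, ∀ z : Fin n, z.val = q k → (slackPoly c y).eval (t z) = 0) :
    (slackPoly c y).coeff d ≤ 0 := by
  -- The nodes `q 0, q 0 + 1, q 1, q 1 + 1, …, q m`: zeros at the even positions, nonnegative values
  -- at the odd ones.
  let u : ℕ → ℕ := fun k => q (k / 2) + k % 2
  have hu : StrictMono u := strictMono_nat_of_lt_succ fun k => by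
    simp only [u]
    rcases Nat.even_or_odd' k with ⟨a, rfl | rfl⟩
    · rw [show (2 * a + 1) / 2 = a by omega, show 2 * a / 2 = a by omega]; omega
    · rw [show (2 * a + 1 + 1) / 2 = a + 1 by omega, show (2 * a + 1) / 2 = a by omega]
      have := hgap a; omega
  have hud : u d = q m := by simp [u, hd]
  have hun : ∀ k : Fin (d + 1), u k.val < n := fun k => by
    have := hu.monotone (Nat.lt_succ_iff.1 k.2)
    omega
  refine coeff_nonpos_of_odd_nonneg ⟨m, by omega⟩
    (x := fun k : Fin (d + 1) => t ⟨u k.val, hun k⟩)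
    (fun a b hab => ht (Fin.lt_def.2 (hu (Fin.lt_def.1 hab)))) (natDegree_slackPoly_le c y)
    (fun k hk => ?_) fun k _ => mem_polarPolytope_iff.1 hy _
  have := k.2
  have := Nat.even_iff.1 hk
  exact hq (k.val / 2) (by omega) _ (by simp only [u]; omega)

/-- Either the interior zeros contain `s - 1` separated indices, which are the corners of a
staircase containing the support, or few adjacent pairs cover them and the face contains a point
with nonpositive leading coefficient. -/
theorem exists_chain_of_mem_lowerPolarComplex {r s d n : ℕ} (hr : 1 ≤ r) (hs : 1 ≤ s)
    (hd : d = 2 * s - 2) (hn : n = r + d) {t : Fin n → ℝ} (ht : StrictMono t) {c : Fin d → ℝ}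
    (hc : c ∈ interior (cyclicPolytope d t)) {F : Set (Fin d → ℝ)}
    (hF : F ∈ lowerPolarComplex d t c) :
    ∃ l : RowCoveringChain r s, polarFace t c (indexSupport n l.1) = F := by
  classical
  obtain ⟨hexp, hne, hpos⟩ := (mem_lowerPolarComplex_iff ⟨s - 1, by omega⟩ (by omega) ht hc).1 hF
  obtain ⟨y, hyF, hFy⟩ := exists_eq_polarFace hexp hne
  have hyP := hexp.subset hyF
  suffices h : ∃ l : RowCoveringChain r s, indexSupport n l.1 = slackSupport t c y by
    obtain ⟨l, hl⟩ := h
    exact ⟨l, by rw [hl, ← hFy]⟩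
  -- The two end indices are left out: they cannot be corners of a staircase, and the end factor in
  -- `exists_poly_of_cover` vanishes there anyway.
  set J : Finset ℕ := ((slackZeros t c y).image Fin.val).filter fun j => 1 ≤ j ∧ j + 2 ≤ n with hJ
  have hJmem : ∀ j, j ∈ J ↔ (∃ z ∈ slackZeros t c y, z.val = j) ∧ 1 ≤ j ∧ j + 2 ≤ n := fun j => by
    simp [hJ]
  rcases exists_gaps_or_cover (s - 1) J with ⟨e, he, hgap⟩ | ⟨T, hTJ, hcard, hcov⟩
  · obtain ⟨rho, hmono, h0, hle, hlast, hrho⟩ := exists_stair_of_gaps hr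
      (fun k hk => ((hJmem _).1 (he k hk)).2.1)
      (fun k hk => by have := ((hJmem _).1 (he k hk)).2.2; omega) hgap
    refine exists_chain_of_stair hr (by omega) hs hmono h0 hle hlast (fun z hz k hk hzk => ?_) ?_
    · obtain ⟨⟨z', hz', hz'k⟩, -⟩ := (hJmem _).1 (he k hk)
      rw [show z = z' from Fin.ext (by rw [hz'k, hzk, hrho k hk])] at hz
      exact hz (mem_slackZeros.1 hz')
    · intro q hq hqn
      by_contra hcon
      push Not at hcon
      refine absurd (hpos y hyF) (not_lt.2 (coeff_nonpos_of_gaps (m := s - 1) (by omega) ht hyP hq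
        hqn fun k hk z hz => ?_))
      by_contra hne
      exact hcon k (by omega) z hne hz
  · exfalso
    obtain ⟨p, hp0, hpd, hpc, hpn, hpz⟩ := exists_poly_of_cover (d := d) ht (by omega) (T := T)
      (fun j hj => by have := ((hJmem j).1 (hTJ hj)).2.2; omega) (by omega)
    obtain ⟨z, hzP, a, ha, hza⟩ := exists_mem_polarPolytope hc hpd hpn hp0
    have hzF : z ∈ F := by
      rw [hFy]
      refine ⟨hzP, slackZeros_subset_iff.1 fun i hi => ?_⟩
      rw [mem_slackZeros, hza, eval_mul, hpz i, mul_zero]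
      by_cases h1 : i.val = 0
      · exact Or.inl h1
      by_cases h2 : i.val = n - 1
      · exact Or.inr (Or.inl h2)
      have := i.2
      exact Or.inr (Or.inr (hcov _ ((hJmem _).2 ⟨⟨i, hi, rfl⟩, by omega, by omega⟩)))
    have h1 := hpos z hzF
    rw [hza, coeff_C_mul] at h1
    nlinarith

theorem exists_isChainComplex_lowerPolarComplex {r s d n : ℕ} (hr : 1 ≤ r) (hs : 1 ≤ s)
    (hd : d = 2 * s - 2) (hn : n = r + d) {t : Fin n → ℝ} (ht : StrictMono t) {c : Fin d → ℝ}
    (hc : c ∈ interior (cyclicPolytope d t)) :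
    ∃ v : (Fin r →o Fin s) → Fin d → ℝ,
      (∀ f, slackZeros t c (v f) = graphCompl hd hn f) ∧
      IsChainComplex (lowerPolarComplex d t c)
        (fun l : RowCoveringChain r s => polarFace t c (indexSupport n l.1)) v := by
  choose v hvP hvz using exists_slackZeros_eq_graphCompl (r := r) (s := s) hd hn ht hc
  have hcard : ∀ f, (slackZeros t c (v f)).card = d := fun f => by rw [hvz, card_graphCompl]
  have hsupp : ∀ f, slackSupport t c (v f) = indexSupport n (graph f).1 := by
    intro f
    ext i
    rw [← not_iff_not, ← mem_graphCompl (hd := hd) (hn := hn), ← hvz, mem_slackZeros]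
    exact not_not
  have hmem : ∀ f (l : RowCoveringChain r s),
      v f ∈ polarFace t c (indexSupport n l.1) ↔ graph f ≤ l := by
    intro f l
    constructor
    · intro h
      refine graph_le_of_indexSupport_subset hd hn ?_
      rw [← hsupp]
      exact h.2
    · intro h
      refine ⟨hvP f, ?_⟩
      rw [hsupp]
      exact indexSupport_mono h
  have hK := fun F => mem_lowerPolarComplex_iff (d := d) (n := n) ⟨s - 1, by omega⟩ (by omega) ht hc
    (F := F)
  have hcell : ∀ l : RowCoveringChain r s,
      polarFace t c (indexSupport n l.1) ∈ lowerPolarComplex d t c := by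
    intro l
    refine (hK _).2 ⟨isExposed_polarFace t c _, ?_,
      fun y hy => coeff_pos_of_mem_polarFace hr hd hn ht l hy⟩
    obtain ⟨j, hj⟩ := l.2.2 ⟨0, hr⟩
    obtain ⟨f, -, hf⟩ := l.exists_monotone_mem hj
    exact ⟨v f, (hmem f l).2 (graph_le_iff.2 hf)⟩
  have hconv : ∀ l : RowCoveringChain r s, Convex ℝ (polarFace t c (indexSupport n l.1)) :=
    fun l => (isExposed_polarFace t c _).convex (convex_polarPolytope _ _)
  refine ⟨v, hvz, hcell, fun C hC => exists_chain_of_mem_lowerPolarComplex hr hs hd hn ht hc hC,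
    fun l l' h y hy => ⟨hy.1, hy.2.trans (indexSupport_mono h)⟩, hconv, hmem, fun f => ?_,
    fun f l h => ?_, fun f g i₀ h => ?_⟩
  · rw [← hsupp, polarFace_slackSupport_of_card ht (hvP f) (hcard f)]
  · exact inter_extremePoints_subset_extremePoints_of_subset (fun y hy => hy.1)
      ⟨(hmem f l).2 h, mem_extremePoints_of_card ht (hvP f) (hcard f)⟩
  · have hcpt : IsCompact (polarFace t c (indexSupport n (ofPair f g h).1)) :=
      (isExposed_polarFace t c _).isCompact (isCompact_polarPolytope hc)
    rw [← closure_convexHull_extremePoints hcpt (hconv _)]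
    have hclosed : IsClosed (segment ℝ (v f) (v g)) := by
      rw [← convexHull_pair]
      exact (Set.toFinite {v f, v g}).isClosed_convexHull ℝ
    refine closure_minimal (convexHull_min ?_ (convex_segment _ _)) hclosed
    intro y hy
    have hyext := (isExposed_polarFace t c _).isExtreme.extremePoints_subset_extremePoints hy
    have hycard := card_slackZeros_of_mem_extremePoints ht hyext
    -- Every extreme point of the face is itself a cell of the complex, hence `v u` for some `u`;
    -- its graph lies in the union of the graphs of `f` and `g`, so `u` is `f` or `g`.
    have hyK : {y} ∈ lowerPolarComplex d t c := by
      rw [← polarFace_slackSupport_of_card ht hyext.1 hycard, hK]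
      refine ⟨isExposed_polarFace t c _, ⟨y, hyext.1, subset_rfl⟩, fun z hz => ?_⟩
      rw [polarFace_slackSupport_of_card ht hyext.1 hycard] at hz
      rw [Set.mem_singleton_iff.1 hz]
      exact coeff_pos_of_mem_polarFace hr hd hn ht _ hy.1
    obtain ⟨l, hl⟩ := exists_chain_of_mem_lowerPolarComplex (r := r) hr hs hd hn ht hc hyK
    obtain ⟨j, hj⟩ := l.2.2 ⟨0, hr⟩
    obtain ⟨u, -, hu⟩ := l.exists_monotone_mem hj
    have huy : v u = y := by
      have := (hmem u l).2 (graph_le_iff.2 hu)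
      rw [hl] at this
      exact this
    have hule := (hmem u (ofPair f g h)).1 (huy ▸ hy.1)
    rw [graph_le_iff] at hule
    rw [← huy]
    rcases mem_ofPair.1 (hule i₀) with h1 | h1
    · rw [show u = f from OrderHom.ext _ _ (funext fun i => by
        rcases mem_ofPair.1 (hule i) with h2 | h2
        · exact h2
        · by_cases hi : i = i₀
          · rw [hi]; exact h1
          · rw [h i hi]; exact h2)]
      exact left_mem_segment _ _ _
    · rw [show u = g from OrderHom.ext _ _ (funext fun i => by
        rcases mem_ofPair.1 (hule i) with h2 | h2
        · by_cases hi : i = i₀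
          · rw [hi]; exact h1
          · rw [← h i hi]; exact h2
        · exact h2)]
      exact right_mem_segment _ _ _

/-- All points of the face vanish at the `s - 1` odd nodes, leaving at most `d - (s - 1) = d/2`
dimensions. -/
theorem two_mul_affineDim_le {r s d n : ℕ} (hr : 1 ≤ r) (hd : d = 2 * s - 2)
    (hn : n = r + d) {t : Fin n → ℝ} (ht : StrictMono t) {c y : Fin d → ℝ}
    (l : RowCoveringChain r s) (hy : y ∈ polarFace t c (indexSupport n l.1))
    (hcard : (slackZeros t c y).card = d) :
    2 * affineDim (polarFace t c (indexSupport n l.1)) ≤ (d : ℤ) := by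
  classical
  obtain ⟨X, hX, hodd⟩ := exists_nodes_of_chain hr hd hn l
  let u : Fin (s - 1) → Fin n := fun k => X ⟨2 * k.val + 1, by have := k.2; omega⟩
  have hu : Function.Injective u := by
    intro a b hab
    have := Fin.mk.inj (hX.injective hab)
    exact Fin.ext (by omega)
  have h1 := finrank_vectorSpan_add_card_le ht hy hcard (J := Finset.univ.image u)
    (fun z hz i hi => by
      obtain ⟨k, -, rfl⟩ := Finset.mem_image.1 hi
      exact mem_slackZeros.2 (eval_slackPoly_eq_zero_of_mem_polarFace hz
        (hodd _ (by simp))))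
  rw [Finset.card_image_of_injective _ hu, Finset.card_univ, Fintype.card_fin] at h1
  rw [affineDim, if_neg (Set.nonempty_iff_ne_empty.1 ⟨y, hy⟩)]
  omega

end LowerPolar

theorem theorem5p5 (r s d n : ℕ) (hr : 1 ≤ r) (hs : 1 ≤ s) (hd : d = 2 * s - 2) (hn : n = r + d)
    (t : Fin n → ℝ) (ht : StrictMono t)
    (c : Fin d → ℝ) (hc : c ∈ interior (cyclicPolytope d t)) :
    -- the two complexes have isomorphic face posets
    Nonempty (mixedSubdivision r s ≃o lowerPolarComplex d t c) ∧
    -- faces have dimension at most `d / 2` (the number `d` is even)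
    (∀ F ∈ lowerPolarComplex d t c, 2 * affineDim F ≤ (d : ℤ)) ∧
    -- the 1-skeleton of `𝒞(r,s)` is `C(r,s)`, with `a` at the point `((1/r, …, 1/r), a/r)`
    (∃ e : oneSkeleton (mixedSubdivision r s) ≃g compositionGraph r s,
      ∀ p, p.1 = (fun _ => 1 / (r : ℝ), fun k => ((e p).1 k : ℝ) / (r : ℝ))) ∧
    -- the 1-skeleton of the polar subcomplex is `C(r,s)`, where `a` labels the vertex dual to the
    -- lower facet whose vector of hole sizes is `a`
    (∃ e : oneSkeleton (lowerPolarComplex d t c) ≃g compositionGraph r s,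
      ∀ p, ∀ k : Fin s,
        holeSize (indexSet d t (dualFace (cyclicPolytope d t) c p.1)) k.val = (e p).1 k) := by
 
  obtain ⟨v, hv, hK⟩ := exists_isChainComplex_lowerPolarComplex hr hs hd hn ht hc
  have hM := isChainComplex_mixedSubdivision hr hs
  refine ⟨⟨hM.orderIso.symm.trans hK.orderIso⟩, fun F hF => ?_, ?_, ?_⟩
  · obtain ⟨l, rfl⟩ := hK.exists_cell F hF
    obtain ⟨j, hj⟩ := l.2.2 ⟨0, hr⟩
    obtain ⟨f, -, hf⟩ := l.exists_monotone_mem hj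
    exact two_mul_affineDim_le hr hd hn ht l ((hK.vertex_mem_iff f l).2 (RowCoveringChain.graph_le_iff.2 hf))
      (by rw [hv, card_graphCompl])
  · obtain ⟨e, he⟩ := hM.exists_skeleton_iso hr
    refine ⟨e, fun p => ?_⟩
    obtain ⟨f, hf⟩ := hM.exists_vertex_eq hr p.2
    rw [he p f hf.symm, ← hf]
    rfl
  · obtain ⟨e, he⟩ := hK.exists_skeleton_iso hr
    refine ⟨e, fun p k => ?_⟩
    obtain ⟨f, hf⟩ := hK.exists_vertex_eq hr p.2
    rw [he p f hf.symm, ← hf, indexSet_dualFace, hv, holeSize_graphCompl]
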